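/- Let $d>0$, $\mathcal D_d=\{z\in\mathbb C: |\operatorname{Im} z|<d\}$, and let $w:\mathcal D_d\to\mathbb C$ be a weight function, i.e. (1) $w$ is analytic and non-vanishing on $\mathcal D_d$ with values in $(0,1]$ on $\mathbb R$; (2) $\lim_{x\to\pm\infty}\int_{-d}^{d}|w(x+iy)|\,dy=0$, and $\lim_{y\nearrow d}\int_{-\infty}^{\infty}(|w(x+iy)|+|w(x-iy)|)\,dx$ exists and is finite; (3) $\log w$ is strictly concave on $\mathbb R$. Put $T_d(x)=\tanh\left(\frac{\pi x}{4d}\right)$, $K(x)=-\log|T_d(x)|$ (so $K(0)=+\infty$) and $Q(x)=-\log w(x)$ for $x\in\mathbb R$. For $n\ge 2$ and a positive Borel measure $\mu$ on $\mathbb R$ with $\mu(\mathbb R)=n$ let $I^{\mathrm C}(\mu)=\iint K(x-y)\,d\mu(x)\,d\mu(y)+2\int Q\,d\mu$, and for real $a_1<\dots<a_n$ let $I^{\mathrm D}(a)=\sum_{i\ne j}K(a_i-a_j)+\frac{2(n-1)}{n}\sum_{i=1}^n Q(a_i)$. For every $n\ge2$ both energies attain their minimum. For any minimizer $\mu^*$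 of $I^{\mathrm C}$ among all such measures and any minimizer $a^*$ of $I^{\mathrm D}$ among all such sequences, the numbers $$F^{\mathrm C}_{K,Q}(n)=\iint K(x-y)\,d\mu^*(x)\,d\mu^*(y)+\int Q\,d\mu^*,\qquad F^{\mathrm D}_{K,Q}(n)=I^{\mathrm D}(a^*)-\frac{n-1}{n}\sum_{i=1}^nQ(a^*_i)$$ are finite and satisfy $$\frac{F^{\mathrm D}_{K,Q}(n)}{n-1}\le\frac{F^{\mathrm C}_{K,Q}(n)}{n}\le\frac{n}{n-1}\left(\frac{2F^{\mathrm D}_{K,Q}(n)}{n-1}+3+\log 2\right).$$ Consequently, the interpolation formula with nodes $a^*$ is nearly optimal. For analytic $f$ on $\mathcal D_d$ let $\|f\|=\sup_{z\in\mathcal D_d}|f(z)/w(z)|$, let $$L_n[a;f](x)=\sum_{k=1}^n f(a_k)\frac{B_{n;k}(x;a)\,w(x)}{B_{n;k}(a_k;a)\,w(a_k)}\frac{T_d'(x-a_k)}{T_d'(0)},\qquad B_{n;k}(x;a)=\prod_{j\ne k}\frac{T_d(x)-T_d(a_j)}{1-T_d(a_j)T_d(x)},$$ and let $E_n^{\min}$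 be the infimum of $$\sup_{\|f\|\le1,\;x\in\mathbb R}\Big|f(x)-\sum_{j=1}^l\sum_{k=0}^{m_j-1}f^{(k)}(p_j)\phi_{jk}(x)\Big|$$ over all $1\le l\le n$, integers $m_j\ge1$ with $m_1+\dots+m_l=n$, distinct points $p_1,\dots,p_l\in\mathcal D_d$ and analytic functions $\phi_{jk}:\mathcal D_d\to\mathbb C$. Then for every $\varepsilon>0$ and all sufficiently large $n$, every minimizer $a^*$ of $I^{\mathrm D}$ satisfies $$\sup_{\|f\|\le1,\;x\in\mathbb R}\left|f(x)-L_n[a^*;f](x)\right|\le\sqrt{2e^3}\,\left(E_n^{\min}\right)^{\frac1{2+\varepsilon}}.$$ -/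

import Mathlib

open Filter Topology MeasureTheory
open scoped ENNReal NNReal

noncomputable section

namespace HardyInterp

/-- The open strip of half-width `d` around the real axis. -/
def strip (d : ℝ) : Set ℂ := {z | |z.im| < d}

/-- Weight functions on the strip. Only the values of `w` on the strip matter.
The integrals are Lebesgue integrals with values in `[0, ∞]`. -/
structure IsWeight (d : ℝ) (w : ℂ → ℂ) : Prop where
  analytic : AnalyticOnNhd ℂ w (strip d)
  ne_zero : ∀ z ∈ strip d, w z ≠ 0
  real_values : ∀ x : ℝ, (w x).im = 0 ∧ 0 < (w x).re ∧ (w x).re ≤ 1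
  vertical_atTop : Tendsto
    (fun x : ℝ => ∫⁻ y in Set.Ioo (-d) d, ‖w (x + y * Complex.I)‖ₑ) atTop (𝓝 0)
  vertical_atBot : Tendsto
    (fun x : ℝ => ∫⁻ y in Set.Ioo (-d) d, ‖w (x + y * Complex.I)‖ₑ) atBot (𝓝 0)
  horizontal : ∃ L : ℝ≥0, Tendsto
    (fun y : ℝ => ∫⁻ x : ℝ, (‖w (x + y * Complex.I)‖ₑ + ‖w (x - y * Complex.I)‖ₑ))
    (𝓝[<] d) (𝓝 (L : ℝ≥0∞))
  log_strictConcave : StrictConcaveOn ℝ Set.univ (fun x : ℝ => Real.log (w x).re)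

/-- The function `x ↦ tanh (π x / (4 d))`. -/
def T (d x : ℝ) : ℝ := Real.tanh (Real.pi / (4 * d) * x)

/-- The kernel `-log |tanh (π x / (4 d))|` as a real number; it is used only for `x ≠ 0`. -/
def kernelReal (d x : ℝ) : ℝ := -Real.log |T d x|

/-- The kernel `-log |tanh (π x / (4 d))|` with values in `[0, ∞]`; it is `∞` at `0`. -/
def kernel (d x : ℝ) : ℝ≥0∞ := if x = 0 then ⊤ else ENNReal.ofReal (kernelReal d x)

/-- The external field `Q = -log w` on the real line (nonnegative for a weight function). -/
def field (w : ℂ → ℂ) (x : ℝ) : ℝ := -Real.log (w x).re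

/-- `∬ K(x - y) dμ(x) dμ(y)`. -/
def interaction (d : ℝ) (μ : Measure ℝ) : ℝ≥0∞ := ∫⁻ y, ∫⁻ x, kernel d (x - y) ∂μ ∂μ

/-- `∫ Q dμ`. -/
def fieldEnergy (w : ℂ → ℂ) (μ : Measure ℝ) : ℝ≥0∞ := ∫⁻ x, ENNReal.ofReal (field w x) ∂μ

/-- The energy `∬ K(x - y) dμ(x) dμ(y) + 2 ∫ Q dμ`. -/
def contEnergy (d : ℝ) (w : ℂ → ℂ) (μ : Measure ℝ) : ℝ≥0∞ :=
  interaction d μ + 2 * fieldEnergy w μ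

/-- `μ` minimizes the energy among the Borel measures on the line of total mass `n`. -/
def IsContMinimizer (d : ℝ) (w : ℂ → ℂ) (n : ℕ) (μ : Measure ℝ) : Prop :=
  μ Set.univ = n ∧ ∀ ν : Measure ℝ, ν Set.univ = n → contEnergy d w μ ≤ contEnergy d w ν

/-- The value `∬ K(x - y) dμ(x) dμ(y) + ∫ Q dμ`, that is the energy minus `∫ Q dμ`. -/
def contF (d : ℝ) (w : ℂ → ℂ) (μ : Measure ℝ) : ℝ≥0∞ := interaction d μ + fieldEnergy w μ

/-- The discrete energy `∑_{i ≠ j} K(a_i - a_j) + (2 (n - 1) / n) ∑ Q(a_i)`. -/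
def discEnergy (d : ℝ) (w : ℂ → ℂ) {n : ℕ} (a : Fin n → ℝ) : ℝ :=
  (∑ i, ∑ j ∈ Finset.univ.erase i, kernelReal d (a i - a j))
    + 2 * ((n : ℝ) - 1) / n * ∑ i, field w (a i)

/-- `a` minimizes the discrete energy among the strictly increasing sequences of length `n`. -/
def IsDiscMinimizer (d : ℝ) (w : ℂ → ℂ) {n : ℕ} (a : Fin n → ℝ) : Prop :=
  StrictMono a ∧ ∀ b : Fin n → ℝ, StrictMono b → discEnergy d w a ≤ discEnergy d w b

/-- The discrete energy minus `((n - 1) / n) ∑ Q(a_i)`. -/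
def discF (d : ℝ) (w : ℂ → ℂ) {n : ℕ} (a : Fin n → ℝ) : ℝ :=
  discEnergy d w a - ((n : ℝ) - 1) / n * ∑ i, field w (a i)

/-- The weighted sup norm `sup |f / w|` over the strip. -/
def hardyNorm (d : ℝ) (w f : ℂ → ℂ) : ℝ≥0∞ := ⨆ z ∈ strip d, ‖f z / w z‖ₑ

/-- The unit ball of the weighted Hardy space. -/
def unitBall (d : ℝ) (w : ℂ → ℂ) : Set (ℂ → ℂ) :=
  {f | AnalyticOnNhd ℂ f (strip d) ∧ hardyNorm d w f ≤ 1}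

/-- The worst error on the real line, over the unit ball, of an approximation operator `A`. -/
def worstError (d : ℝ) (w : ℂ → ℂ) (A : (ℂ → ℂ) → ℝ → ℂ) : ℝ≥0∞ :=
  ⨆ f ∈ unitBall d w, ⨆ x : ℝ, ‖f x - A f x‖ₑ

/-- The Hermite type formula `∑_j ∑_{k < m_j} f^(k)(p_j) φ_{jk}(x)`. -/
def hermiteFormula {l : ℕ} (m : Fin l → ℕ) (p : Fin l → ℂ) (φ : Fin l → ℕ → ℂ → ℂ)
    (f : ℂ → ℂ) (x : ℝ) : ℂ :=
  ∑ j, ∑ k ∈ Finset.range (m j), iteratedDeriv k f (p j) * φ j k x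

/-- The minimum worst error of `n`-point formulas. -/
def minError (d : ℝ) (w : ℂ → ℂ) (n : ℕ) : ℝ≥0∞ :=
  sInf {E | ∃ (l : ℕ) (m : Fin l → ℕ) (p : Fin l → ℂ) (φ : Fin l → ℕ → ℂ → ℂ),
    1 ≤ l ∧ l ≤ n ∧ (∀ j, 1 ≤ m j) ∧ ∑ j, m j = n ∧
    Function.Injective p ∧ (∀ j, p j ∈ strip d) ∧
    (∀ j, ∀ k < m j, AnalyticOnNhd ℂ (φ j k) (strip d)) ∧
    E = worstError d w (hermiteFormula m p φ)}

/-- The product `∏_{j ≠ k} (T x - T a_j) / (1 - T a_j T x)`. -/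
def blaschkeOmit (d : ℝ) {n : ℕ} (a : Fin n → ℝ) (k : Fin n) (x : ℝ) : ℝ :=
  ∏ j ∈ Finset.univ.erase k, (T d x - T d (a j)) / (1 - T d (a j) * T d x)

/-- The interpolation formula with nodes `a`. -/
def interp (d : ℝ) (w : ℂ → ℂ) {n : ℕ} (a : Fin n → ℝ) (f : ℂ → ℂ) (x : ℝ) : ℂ :=
  ∑ k, f (a k) * ((blaschkeOmit d a k x * w x) / (blaschkeOmit d a k (a k) * w (a k)))
    * ((deriv (T d) (x - a k) / deriv (T d) 0 : ℝ) : ℂ)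

end HardyInterp

end

/-!
The argument is potential theoretic. Write `U^σ(y) = ∫ K(x - y) dσ(x)`, and let `F` be the value
`contF d w μ` of a minimizer `μ` of the continuous energy.

*Existence.* The kernel is a continuous function with values in `[0, ∞]`, so the energy is lower
semicontinuous for weak convergence of measures. The field `Q` tends to infinity: `w` tends to zero
on the line because the integrals of `|w|` over vertical segments do and `w` has the mean value
property on discs (`IsWeight.exists_le_field`). Hence sublevel sets of the energy are tight, and
Prokhorov's theorem gives a minimizer (`exists_isEquilibrium`). The discrete case is compactness in
`ℝⁿ`.

*Duality.* The potential of `μ` satisfies `U^μ + Q ≤ F / n` on the support of `μ` (Frostman). Let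
`ω` be the equilibrium probability measure, without field, of the compact support of `μ`, and `κ`
its constant. Because `K` is decreasing and convex on the half-line, potentials on the line obey a
maximum principle, which gives `U^ω ≤ κ` everywhere, while `U^ω` is at least `κ` in the mean with
respect to `μ`. Integrating `U^ν + Q` against `ω` shows that `inf (U^ν + Q) ≤ F / n` for every
measure `ν` of mass `n` (`IsEquilibrium.le_robin_of_le_potential`,
`IsContMinimizer.mul_le_contF`).

*Comparison of the energies.* Summing over `i` the optimality of the `i`-th point of a minimizer
`a` of the discrete energy gives `∑ K(x - a_j) + Q(x) ≥ discF a / (n - 1)` for all `x`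
(`IsDiscMinimizer.discF_le`); with duality this is the lower estimate of `F`. For the upper
estimate, `a` is smeared uniformly over the `n - 1` intervals between its points, with total mass
`n`. Pairs of distant intervals cost at most the kernel at the inner end points, adjacent and
equal ones at most the kernel at the outer end points plus `1` and `1 + log 2`
(`exists_contEnergy_le`). The factor `2` in front of the discrete energy pays for using both the
inner and the outer end points.

*Errors.* By Cauchy's formula on the disc, the error of the interpolation formula at `x` is at most
`w(x) ∏ |T(x - a_j)|`, hence at most `exp (-discF a / (n - 1))`
(`IsDiscMinimizer.worstError_interp_le`). Conversely a Hermite type formula vanishes on the weighted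
Blaschke product with zeros at its nodes, whose modulus on the line does not increase when the zeros
are projected to the line; by duality its supremum is at least `exp (-F / n)`
(`IsContMinimizer.exp_le_minError`). The comparison of the energies relates the two exponents.
-/

open scoped ComplexConjugate

namespace HardyInterp

section

/-! ### The hyperbolic tangent and the kernel -/

lemma hasDerivAt_tanh (x : ℝ) : HasDerivAt Real.tanh (1 / Real.cosh x ^ 2) x := by
  have h := (Real.hasDerivAt_sinh x).div (Real.hasDerivAt_cosh x) (Real.cosh_pos x).ne'
  have e : Real.tanh = Real.sinh / Real.cosh := by
    ext y; exact Real.tanh_eq_sinh_div_cosh y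
  rw [e]
  exact h.congr_deriv (by rw [← Real.cosh_sq_sub_sinh_sq x]; ring)

lemma deriv_tanh : deriv Real.tanh = fun x => 1 / Real.cosh x ^ 2 :=
  funext fun x => (hasDerivAt_tanh x).deriv

lemma continuous_tanh : Continuous Real.tanh :=
  continuous_iff_continuousAt.2 fun x => (hasDerivAt_tanh x).continuousAt

lemma strictMono_tanh : StrictMono Real.tanh :=
  strictMono_of_deriv_pos fun x => by
    rw [deriv_tanh]; have := Real.cosh_pos x; positivity

lemma concaveOn_tanh : ConcaveOn ℝ (Set.Ici 0) Real.tanh := by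
  refine AntitoneOn.concaveOn_of_deriv (convex_Ici 0) continuous_tanh.continuousOn
    (fun x _ => (hasDerivAt_tanh x).differentiableAt.differentiableWithinAt) ?_
  intro x hx y hy hxy
  simp only [interior_Ici, Set.mem_Ioi] at hx hy
  rw [deriv_tanh]
  have h1 : Real.cosh x ≤ Real.cosh y := by
    rw [Real.cosh_le_cosh, abs_of_pos hx, abs_of_pos hy]; exact hxy
  have := Real.cosh_pos x
  dsimp only
  gcongr

variable {d : ℝ}

lemma T_zero : T d 0 = 0 := by simp [T]

lemma T_neg (x : ℝ) : T d (-x) = -T d x := by simp [T]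

lemma continuous_T : Continuous (T d) := continuous_tanh.comp (by fun_prop)

lemma strictMono_T (hd : 0 < d) : StrictMono (T d) := fun x y h =>
  strictMono_tanh (by have := Real.pi_pos; gcongr)

lemma T_pos (hd : 0 < d) {x : ℝ} (hx : 0 < x) : 0 < T d x := by
  simpa [T_zero] using strictMono_T hd hx

lemma abs_T_lt_one (x : ℝ) : |T d x| < 1 := Real.abs_tanh_lt_one _

lemma T_ne_zero (hd : 0 < d) {x : ℝ} (hx : x ≠ 0) : T d x ≠ 0 := fun h =>
  hx ((strictMono_T hd).injective (h.trans T_zero.symm))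

lemma abs_T_pos (hd : 0 < d) {x : ℝ} (hx : x ≠ 0) : 0 < |T d x| := abs_pos.2 (T_ne_zero hd hx)

lemma abs_T_abs (hd : 0 < d) (x : ℝ) : |T d x| = T d |x| := by
  rcases le_total 0 x with h | h
  · rw [abs_of_nonneg h, abs_of_nonneg]
    simpa [T_zero] using (strictMono_T hd).monotone h
  · rw [abs_of_nonpos h, T_neg, abs_of_nonpos]
    simpa [T_zero] using (strictMono_T hd).monotone h

lemma concaveOn_T (hd : 0 < d) : ConcaveOn ℝ (Set.Ici 0) (T d) := by
  have hc : 0 < Real.pi / (4 * d) := by have := Real.pi_pos; positivity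
  refine ⟨convex_Ici 0, fun x hx y hy a b ha hb hab => ?_⟩
  have := concaveOn_tanh.2 (x := Real.pi / (4 * d) * x) (mul_nonneg hc.le hx)
    (y := Real.pi / (4 * d) * y) (mul_nonneg hc.le hy) ha hb hab
  simp only [T, smul_eq_mul] at this ⊢
  convert this using 2
  ring

/-- The addition theorem of the hyperbolic tangent. -/
lemma T_sub (x y : ℝ) : (T d x - T d y) / (1 - T d y * T d x) = T d (x - y) := by
  have hx := Real.cosh_pos (Real.pi / (4 * d) * x)
  have hy := Real.cosh_pos (Real.pi / (4 * d) * y)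
  have hxy := Real.cosh_pos (Real.pi / (4 * d) * (x - y))
  simp only [T, mul_sub] at *
  rw [Real.cosh_sub] at hxy
  simp only [Real.tanh_eq_sinh_div_cosh, Real.cosh_sub, Real.sinh_sub]
  have h : 1 - Real.sinh (Real.pi / (4 * d) * y) / Real.cosh (Real.pi / (4 * d) * y) *
      (Real.sinh (Real.pi / (4 * d) * x) / Real.cosh (Real.pi / (4 * d) * x)) ≠ 0 := by
    rw [div_mul_div_comm, one_sub_div (by positivity)]
    exact (div_pos (by linarith) (by positivity)).ne'
  rw [div_eq_div_iff h hxy.ne']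
  field_simp

lemma kernelReal_zero : kernelReal d 0 = 0 := by simp [kernelReal, T_zero]

lemma kernelReal_neg (x : ℝ) : kernelReal d (-x) = kernelReal d x := by
  simp [kernelReal, T_neg]

lemma kernelReal_sub_comm (x y : ℝ) : kernelReal d (x - y) = kernelReal d (y - x) := by
  rw [← kernelReal_neg, neg_sub]

lemma kernelReal_nonneg (x : ℝ) : 0 ≤ kernelReal d x :=
  neg_nonneg.2 (Real.log_nonpos (abs_nonneg _) (abs_T_lt_one x).le)

lemma kernelReal_of_pos (hd : 0 < d) {x : ℝ} (hx : 0 < x) :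
    kernelReal d x = -Real.log (T d x) := by
  rw [kernelReal, abs_of_pos (T_pos hd hx)]

lemma exp_neg_kernelReal (hd : 0 < d) {x : ℝ} (hx : x ≠ 0) :
    Real.exp (-kernelReal d x) = |T d x| := by
  rw [kernelReal, neg_neg, Real.exp_log (abs_T_pos hd hx)]

lemma kernelReal_anti (hd : 0 < d) {x y : ℝ} (hx : x ≠ 0) (hxy : |x| ≤ |y|) :
    kernelReal d y ≤ kernelReal d x := by
  refine neg_le_neg (Real.log_le_log (abs_T_pos hd hx) ?_)
  rw [abs_T_abs hd, abs_T_abs hd]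
  exact (strictMono_T hd).monotone hxy

lemma convexOn_kernelReal (hd : 0 < d) : ConvexOn ℝ (Set.Ioi 0) (kernelReal d) := by
  refine ⟨convex_Ioi 0, fun x hx y hy a b ha hb hab => ?_⟩
  have hx' : 0 < x := hx
  have hy' : 0 < y := hy
  have hz : 0 < a • x + b • y := (convex_Ioi (0 : ℝ)) hx hy ha hb hab
  rw [kernelReal_of_pos hd hz, kernelReal_of_pos hd hx', kernelReal_of_pos hd hy']
  have h1 := (concaveOn_T hd).2 hx'.le hy'.le ha hb hab
  have h2 := strictConcaveOn_log_Ioi.concaveOn.2 (T_pos hd hx') (T_pos hd hy') ha hb hab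
  have h3 : Real.log (a • T d x + b • T d y) ≤ Real.log (T d (a • x + b • y)) :=
    Real.log_le_log ((convex_Ioi (0 : ℝ)) (T_pos hd hx') (T_pos hd hy') ha hb hab) h1
  simp only [smul_eq_mul] at *
  linarith

/-- The singularity of the kernel is logarithmic: shrinking the argument by a factor `u` costs
at most `-log u`. -/
lemma kernelReal_mul_le (hd : 0 < d) {u x : ℝ} (hu : 0 < u) (hu1 : u ≤ 1) (hx : 0 < x) :
    kernelReal d (u * x) ≤ kernelReal d x - Real.log u := by
  rw [kernelReal_of_pos hd hx, kernelReal_of_pos hd (mul_pos hu hx)]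
  have h := (concaveOn_T hd).2 (Set.mem_Ici.2 hx.le) (Set.mem_Ici.2 le_rfl) hu.le
    (sub_nonneg.2 hu1) (by ring)
  simp only [smul_eq_mul, mul_zero, add_zero, T_zero] at h
  have h2 := Real.log_le_log (mul_pos hu (T_pos hd hx)) h
  rw [Real.log_mul hu.ne' (T_pos hd hx).ne'] at h2
  linarith

lemma kernel_zero : kernel d 0 = ⊤ := if_pos rfl

lemma kernel_of_ne {x : ℝ} (hx : x ≠ 0) : kernel d x = ENNReal.ofReal (kernelReal d x) :=
  if_neg hx

lemma kernel_neg (x : ℝ) : kernel d (-x) = kernel d x := by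
  simp [kernel, kernelReal_neg]

lemma kernel_sub_comm (x y : ℝ) : kernel d (x - y) = kernel d (y - x) := by
  rw [← kernel_neg, neg_sub]

lemma kernel_anti (hd : 0 < d) {x y : ℝ} (hxy : |x| ≤ |y|) : kernel d y ≤ kernel d x := by
  rcases eq_or_ne x 0 with rfl | hx
  · simp [kernel_zero]
  have hy : y ≠ 0 := by rintro rfl; simp at hxy; exact hx hxy
  rw [kernel_of_ne hx, kernel_of_ne hy]
  exact ENNReal.ofReal_le_ofReal (kernelReal_anti hd hx hxy)

/-- Convexity of the extended kernel on the closed half-line. -/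
lemma kernel_convex (hd : 0 < d) {x y a b : ℝ} (hx : 0 ≤ x) (hy : 0 ≤ y) (ha : 0 < a)
    (hb : 0 < b) (hab : a + b = 1) : kernel d (a * x + b * y) ≤
      ENNReal.ofReal a * kernel d x + ENNReal.ofReal b * kernel d y := by
  rcases hx.eq_or_lt with rfl | hx
  · simp [kernel_zero, ENNReal.mul_top, ha]
  rcases hy.eq_or_lt with rfl | hy
  · simp [kernel_zero, ENNReal.mul_top, hb]
  rw [kernel_of_ne hx.ne', kernel_of_ne hy.ne', kernel_of_ne (by positivity),
    ← ENNReal.ofReal_mul ha.le, ← ENNReal.ofReal_mul hb.le, ← ENNReal.ofReal_add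
      (mul_nonneg ha.le (kernelReal_nonneg _)) (mul_nonneg hb.le (kernelReal_nonneg _))]
  exact ENNReal.ofReal_le_ofReal ((convexOn_kernelReal hd).2 hx hy ha.le hb.le hab)

lemma continuous_kernel (hd : 0 < d) : Continuous (kernel d) := by
  refine continuous_iff_continuousAt.2 fun x => ?_
  rcases eq_or_ne x 0 with rfl | hx
  · rw [ContinuousAt, kernel_zero, ← nhdsNE_sup_pure, tendsto_sup]
    refine ⟨?_, by simpa [kernel_zero] using tendsto_pure_nhds (kernel d) 0⟩
    have h1 : Tendsto (fun x => |T d x|) (𝓝[≠] 0) (𝓝[>] 0) := by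
      refine tendsto_nhdsWithin_iff.2 ⟨?_, ?_⟩
      · have := (continuous_T (d := d)).abs.tendsto 0
        rw [T_zero, abs_zero] at this
        exact this.mono_left nhdsWithin_le_nhds
      · filter_upwards [self_mem_nhdsWithin] with y hy using abs_T_pos hd hy
    have h2 : Tendsto (kernelReal d) (𝓝[≠] 0) atTop :=
      tendsto_neg_atBot_atTop.comp (Real.tendsto_log_nhdsGT_zero.comp h1)
    refine (ENNReal.tendsto_ofReal_atTop.comp h2).congr' ?_
    filter_upwards [self_mem_nhdsWithin] with y hy
    exact (kernel_of_ne hy).symm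
  · have h : ContinuousAt (fun x => ENNReal.ofReal (kernelReal d x)) x := by
      refine ENNReal.continuous_ofReal.continuousAt.comp ?_
      exact ((continuous_T.abs.continuousAt).log (abs_T_pos hd hx).ne').neg
    refine h.congr ?_
    filter_upwards [isOpen_ne.mem_nhds hx] with y hy
    exact (kernel_of_ne hy).symm

lemma measurable_kernel (hd : 0 < d) : Measurable (kernel d) := (continuous_kernel hd).measurable

end

section

/-! ### Energies of probability measures: lower semicontinuity and existence of minimizers -/

/-- Integrals of continuous `[0, ∞]`-valued functions are lower semicontinuous in the measure. -/
lemma lowerSemicontinuous_lintegral_of_continuous {X : Type*} [TopologicalSpace X]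
    [MeasurableSpace X] [OpensMeasurableSpace X] {g : X → ℝ≥0∞} (hg : Continuous g) :
    LowerSemicontinuous fun σ : ProbabilityMeasure X => ∫⁻ x, g x ∂(σ : Measure X) := by
  have h1 : ∀ (σ : ProbabilityMeasure X), ∫⁻ x, g x ∂(σ : Measure X) =
      ⨆ k : ℕ, ∫⁻ x, min (g x) k ∂(σ : Measure X) := by
    intro σ
    rw [← lintegral_iSup (fun k => (hg.min continuous_const).measurable)
      (fun i j hij x => min_le_min le_rfl (by exact_mod_cast hij))]
    congr with x
    rw [← inf_iSup_eq, ENNReal.iSup_natCast, inf_top_eq]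
  simp_rw [h1]
  refine lowerSemicontinuous_iSup fun k => Continuous.lowerSemicontinuous ?_
  have hk : ∀ x, min (g x) k ≠ ⊤ := fun x =>
    ((min_le_right _ _).trans_lt (ENNReal.natCast_lt_top k)).ne
  have hc : Continuous fun x => (min (g x) k).toNNReal :=
    ENNReal.continuousOn_toNNReal.comp_continuous (hg.min continuous_const) hk
  let f : BoundedContinuousFunction X ℝ≥0 := BoundedContinuousFunction.mkOfBound ⟨_, hc⟩ k (by
    intro x y
    have hb : ∀ z, (min (g z) k).toNNReal ≤ k := fun z => by
      rw [← ENNReal.coe_le_coe, ENNReal.coe_toNNReal (hk z)]; simp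
    rw [NNReal.dist_eq]
    have hx : (((min (g x) k).toNNReal : ℝ≥0) : ℝ) ≤ k := by exact_mod_cast hb x
    have hy : (((min (g y) k).toNNReal : ℝ≥0) : ℝ) ≤ k := by exact_mod_cast hb y
    exact abs_sub_le_of_nonneg_of_le (NNReal.coe_nonneg _) hx (NNReal.coe_nonneg _) hy)
  have h2 : ∀ σ : ProbabilityMeasure X, ∫⁻ x, min (g x) k ∂(σ : Measure X) =
      ∫⁻ x, f x ∂(σ : Measure X) := fun σ => lintegral_congr fun x =>
    (ENNReal.coe_toNNReal (hk x)).symm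
  simp_rw [h2]
  exact continuous_iff_continuousAt.2 fun σ =>
    ProbabilityMeasure.tendsto_iff_forall_lintegral_tendsto.1 tendsto_id f

variable {d : ℝ}

lemma measurable_kernel_sub (hd : 0 < d) :
    Measurable fun p : ℝ × ℝ => kernel d (p.1 - p.2) :=
  (measurable_kernel hd).comp (measurable_fst.sub measurable_snd)

lemma lowerSemicontinuous_interaction (hd : 0 < d) :
    LowerSemicontinuous fun σ : ProbabilityMeasure ℝ => interaction d (σ : Measure ℝ) := by
  have h := lowerSemicontinuous_lintegral_of_continuous
    (g := fun p : ℝ × ℝ => kernel d (p.2 - p.1)) ((continuous_kernel hd).comp (by fun_prop))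
  have h2 : Continuous fun σ : ProbabilityMeasure ℝ => σ.prod σ :=
    ProbabilityMeasure.continuous_prod.comp (continuous_id.prodMk continuous_id)
  have h3 := h.comp h2
  refine cast ?_ h3
  congr 1
  ext σ
  simp only [Function.comp, ProbabilityMeasure.toMeasure_prod, interaction]
  exact lintegral_prod (fun p : ℝ × ℝ => kernel d (p.2 - p.1))
    ((measurable_kernel_sub hd).comp measurable_swap).aemeasurable

/-- The energy `∬ K(x - y) dσ dσ + 2 ∫ V dσ` in an arbitrary external field `V`. -/
noncomputable def energy (d : ℝ) (V : ℝ → ℝ≥0∞) (σ : Measure ℝ) : ℝ≥0∞ :=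
  interaction d σ + 2 * ∫⁻ x, V x ∂σ

/-- `σ` has the least energy among the probability measures. -/
def IsEquilibrium (d : ℝ) (V : ℝ → ℝ≥0∞) (ρ : Measure ℝ) : Prop :=
  IsProbabilityMeasure ρ ∧ ∀ σ : Measure ℝ, IsProbabilityMeasure σ → energy d V ρ ≤ energy d V σ

/-- An equilibrium measure exists if the field is lower semicontinuous, as a function of the
measure, and confining: the measures of bounded energy are then tight. -/
lemma exists_isEquilibrium (hd : 0 < d) {V : ℝ → ℝ≥0∞} (hVm : Measurable V)
    (hV : LowerSemicontinuous fun σ : ProbabilityMeasure ℝ => ∫⁻ x, V x ∂(σ : Measure ℝ))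
    (hVinf : ∀ M : ℝ≥0, ∃ R : ℝ, ∀ x, R < |x| → (M : ℝ≥0∞) ≤ V x) :
    ∃ ρ, IsEquilibrium d V ρ := by
  by_cases hfin : ∃ σ₀ : ProbabilityMeasure ℝ, energy d V σ₀ < ⊤
  swap
  · push Not at hfin
    refine ⟨Measure.dirac 0, inferInstance, fun σ hσ => ?_⟩
    have := hfin ⟨σ, hσ⟩
    exact le_top.trans this
  obtain ⟨σ₀, hσ₀⟩ := hfin
  have hlsc : LowerSemicontinuous fun σ : ProbabilityMeasure ℝ => energy d V (σ : Measure ℝ) := by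
    unfold energy
    simp_rw [two_mul]
    exact (lowerSemicontinuous_interaction hd).add (hV.add hV)
  let S : Set (ProbabilityMeasure ℝ) := {σ | energy d V σ ≤ energy d V σ₀}
  have htight : IsTightMeasureSet {((μ : ProbabilityMeasure ℝ) : Measure ℝ) | μ ∈ S} := by
    rw [isTightMeasureSet_iff_exists_isCompact_measure_compl_le]
    intro ε hε
    set E := energy d V σ₀ with hE
    rcases eq_or_ne ε ⊤ with rfl | hεt
    · exact ⟨∅, isCompact_empty, fun _ _ => le_top⟩
    have hMt : E / ε ≠ ⊤ := (ENNReal.div_lt_top hσ₀.ne hε.ne').ne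
    obtain ⟨R, hR⟩ := hVinf (E / ε + 1).toNNReal
    refine ⟨Set.Icc (-R) R, isCompact_Icc, ?_⟩
    rintro _ ⟨μ, hμ, rfl⟩
    rw [ENNReal.coe_toNNReal (by simp [hMt])] at hR
    have h1 : (E / ε + 1) * (μ : Measure ℝ) (Set.Icc (-R) R)ᶜ ≤ E := calc
      (E / ε + 1) * (μ : Measure ℝ) (Set.Icc (-R) R)ᶜ
        ≤ (E / ε + 1) * (μ : Measure ℝ) {x | E / ε + 1 ≤ V x} := by
          gcongr
          intro x hx
          refine hR x ?_
          by_contra hcon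
          exact hx (abs_le.1 (not_lt.1 hcon))
      _ ≤ ∫⁻ x, V x ∂μ := mul_meas_ge_le_lintegral hVm _
      _ ≤ 2 * ∫⁻ x, V x ∂μ := le_mul_of_one_le_left zero_le (by norm_num)
      _ ≤ energy d V μ := le_add_self
      _ ≤ E := hμ
    by_contra hcon
    push Not at hcon
    have h2 : (E / ε + 1) * ε ≤ E := le_trans (by gcongr) h1
    rw [add_mul, ENNReal.div_mul_cancel hε.ne' hεt, one_mul] at h2
    exact absurd h2 (not_le.2 (ENNReal.lt_add_right hσ₀.ne hε.ne'))
  have h0 : σ₀ ∈ closure S := subset_closure (le_refl (energy d V σ₀))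
  obtain ⟨ρ, -, hρ⟩ := (hlsc.lowerSemicontinuousOn (closure S)).exists_isMinOn
    ⟨σ₀, h0⟩ (isCompact_closure_of_isTightMeasureSet htight)
  refine ⟨ρ, inferInstance, fun σ hσ => ?_⟩
  obtain ⟨τ, rfl⟩ : ∃ τ : ProbabilityMeasure ℝ, (τ : Measure ℝ) = σ := ⟨⟨σ, hσ⟩, rfl⟩
  rcases le_total (energy d V τ) (energy d V σ₀) with h | h
  · exact hρ (subset_closure (show τ ∈ S from h))
  · exact (hρ h0).trans h

end

section

variable {d : ℝ}

/-! ### Frostman conditions and the maximum principle -/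

/-- The potential `∫ K(x - y) dσ(x)` at `y`. -/
noncomputable def potential (d : ℝ) (σ : Measure ℝ) (y : ℝ) : ℝ≥0∞ := ∫⁻ x, kernel d (x - y) ∂σ

lemma measurable_potential (hd : 0 < d) (σ : Measure ℝ) [SFinite σ] :
    Measurable (potential d σ) :=
  ((measurable_kernel_sub hd).comp measurable_swap).lintegral_prod_right'

lemma interaction_eq (σ : Measure ℝ) : interaction d σ = ∫⁻ y, potential d σ y ∂σ := rfl

lemma lintegral_potential_comm (hd : 0 < d) (σ τ : Measure ℝ) [SFinite σ] [SFinite τ] :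
    ∫⁻ y, potential d σ y ∂τ = ∫⁻ y, potential d τ y ∂σ := by
  have h := lintegral_lintegral_swap (μ := τ) (ν := σ) (f := fun y x => kernel d (x - y))
    ((measurable_kernel_sub hd).comp measurable_swap).aemeasurable
  simp_rw [potential, h]
  exact lintegral_congr fun x => lintegral_congr fun y => kernel_sub_comm x y

lemma lowerSemicontinuous_potential (hd : 0 < d) (σ : Measure ℝ) [IsFiniteMeasure σ] :
    LowerSemicontinuous (potential d σ) := by
  have h1 : potential d σ = fun y => ⨆ k : ℕ, ∫⁻ x, min (kernel d (x - y)) k ∂σ := by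
    ext y
    rw [potential, ← lintegral_iSup (f := fun (k : ℕ) x => min (kernel d (x - y)) k)
      (fun k => (((continuous_kernel hd).comp (by fun_prop)).min continuous_const).measurable)
      (fun i j hij x => min_le_min le_rfl (by exact_mod_cast hij))]
    congr with x
    rw [← inf_iSup_eq, ENNReal.iSup_natCast, inf_top_eq]
  rw [h1]
  refine lowerSemicontinuous_iSup fun k => Continuous.lowerSemicontinuous ?_
  refine continuous_iff_continuousAt.2 fun y => ?_
  refine tendsto_lintegral_filter_of_dominated_convergence (fun _ => (k : ℝ≥0∞)) ?_ ?_ ?_ ?_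
  · exact .of_forall fun y => (((continuous_kernel hd).comp
      (continuous_id.sub continuous_const)).min continuous_const).measurable
  · exact .of_forall fun y => .of_forall fun x => min_le_right _ _
  · simp [lintegral_const, ENNReal.mul_eq_top]
  · refine .of_forall fun x => Continuous.tendsto ?_ y
    exact ((continuous_kernel hd).comp (by fun_prop)).min continuous_const

/-- The energy value `∬ K(x - y) dρ dρ + ∫ V dρ`; for an equilibrium measure this is the
constant value of `U + V` on the support. -/
noncomputable def robin (d : ℝ) (V : ℝ → ℝ≥0∞) (ρ : Measure ℝ) : ℝ≥0∞ :=
  interaction d ρ + ∫⁻ x, V x ∂ρ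

lemma robin_le_energy (V : ℝ → ℝ≥0∞) (ρ : Measure ℝ) : robin d V ρ ≤ energy d V ρ := by
  unfold robin energy
  gcongr
  exact le_mul_of_one_le_left zero_le (by norm_num)

lemma robin_eq (hd : 0 < d) {V : ℝ → ℝ≥0∞} (ρ : Measure ℝ) [SFinite ρ] :
    robin d V ρ = ∫⁻ y, (potential d ρ y + V y) ∂ρ := by
  rw [lintegral_add_left (measurable_potential hd ρ), robin, interaction_eq]

/-- The energy is quadratic along segments of measures. -/
lemma energy_segment (hd : 0 < d) (V : ℝ → ℝ≥0∞) (ρ σ : Measure ℝ) [IsFiniteMeasure ρ]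
    [IsFiniteMeasure σ] (a b : ℝ≥0) :
    energy d V (a • ρ + b • σ) = a ^ 2 * interaction d ρ +
      2 * (a * b * ∫⁻ y, potential d ρ y ∂σ) + b ^ 2 * interaction d σ +
      2 * (a * (∫⁻ x, V x ∂ρ) + b * ∫⁻ x, V x ∂σ) := by
  have h1 : ∀ y, potential d (a • ρ + b • σ) y = a * potential d ρ y + b * potential d σ y := by
    intro y
    rw [potential, lintegral_add_measure, lintegral_smul_measure, lintegral_smul_measure]
    rfl
  have h2 := measurable_potential hd ρ
  have h3 := measurable_potential hd σ
  unfold energy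
  simp_rw [interaction_eq, h1]
  rw [lintegral_add_measure, lintegral_add_measure]
  simp only [lintegral_smul_measure, ENNReal.smul_def, smul_eq_mul]
  rw [lintegral_add_left (h2.const_mul _), lintegral_add_left (h2.const_mul _)]
  simp only [lintegral_const_mul _ h2, lintegral_const_mul _ h3]
  rw [lintegral_potential_comm hd σ ρ]
  ring

lemma nonneg_of_forall_quadratic {p q : ℝ}
    (h : ∀ t : ℝ, 0 < t → t < 1 → 0 ≤ t * p + t ^ 2 * q) : 0 ≤ p := by
  by_contra hp
  push Not at hp
  set t := min (1 / 2) (-p / (2 * (|q| + 1))) with ht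
  have hq : 0 < |q| + 1 := by positivity
  have ht0 : 0 < t := lt_min (by norm_num) (div_pos (by linarith) (by positivity))
  have ht1 : t < 1 := (min_le_left _ _).trans_lt (by norm_num)
  have h1 := h t ht0 ht1
  have h2 : t * (|q| + 1) ≤ -p / 2 := by
    have : t ≤ -p / (2 * (|q| + 1)) := min_le_right _ _
    rw [le_div_iff₀ (by positivity)] at this
    linarith
  have h3 : 0 ≤ p + t * q := by
    have : 0 ≤ t * (p + t * q) := by linarith
    exact nonneg_of_mul_nonneg_right this ht0
  have h4 : t * q ≤ t * (|q| + 1) := by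
    gcongr; linarith [le_abs_self q]
  linarith

/-- First order condition at an equilibrium measure, tested on measures of finite energy. -/
lemma IsEquilibrium.robin_le_lintegral (hd : 0 < d) {V : ℝ → ℝ≥0∞} {ρ : Measure ℝ}
    (hρ : IsEquilibrium d V ρ) (hfin : energy d V ρ ≠ ⊤) (σ : Measure ℝ)
    [IsProbabilityMeasure σ] (hσ : energy d V σ ≠ ⊤) :
    robin d V ρ ≤ ∫⁻ y, potential d ρ y ∂σ + ∫⁻ x, V x ∂σ := by
  have := hρ.1
  rcases eq_or_ne (∫⁻ y, potential d ρ y ∂σ) ⊤ with hC | hC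
  · simp [hC]
  obtain ⟨hA, hVρ⟩ := ENNReal.add_ne_top.1 hfin
  obtain ⟨hB, hVσ⟩ := ENNReal.add_ne_top.1 hσ
  have hVρ' : ∫⁻ x, V x ∂ρ ≠ ⊤ := fun h => hVρ (by simp [h])
  have hVσ' : ∫⁻ x, V x ∂σ ≠ ⊤ := fun h => hVσ (by simp [h])
  have key : ∀ t : ℝ, 0 < t → t < 1 → energy d V ρ ≤
      energy d V ((1 - t).toNNReal • ρ + t.toNNReal • σ) := by
    intro t h0 h1
    refine hρ.2 _ ⟨?_⟩
    simp only [Measure.add_apply, Measure.smul_apply, measure_univ, ENNReal.smul_def, smul_eq_mul,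
      mul_one]
    rw [← ENNReal.coe_add, ← Real.toNNReal_add (by linarith) h0.le]
    simp
  simp_rw [energy_segment hd] at key
  unfold energy at key
  unfold robin
  lift interaction d ρ to ℝ≥0 using hA with A
  lift interaction d σ to ℝ≥0 using hB with B
  lift ∫⁻ y, potential d ρ y ∂σ to ℝ≥0 using hC with C
  lift ∫⁻ x, V x ∂ρ to ℝ≥0 using hVρ' with v
  lift ∫⁻ x, V x ∂σ to ℝ≥0 using hVσ' with u
  have key2 := nonneg_of_forall_quadratic (p := 2 * (C + u - A - v)) (q := A - 2 * C + B) (by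
    intro t h0 h1
    have h := key t h0 h1
    norm_cast at h
    rw [← NNReal.coe_le_coe] at h
    push_cast [Real.coe_toNNReal _ h0.le, Real.coe_toNNReal _ (sub_nonneg.2 h1.le)] at h
    nlinarith)
  norm_cast
  rw [← NNReal.coe_le_coe]
  push_cast
  linarith

lemma interaction_mono {σ τ : Measure ℝ} (h : σ ≤ τ) : interaction d σ ≤ interaction d τ :=
  lintegral_mono' h fun _ => lintegral_mono' h le_rfl

lemma interaction_smul {c : ℝ≥0∞} (hc : c ≠ ⊤) (σ : Measure ℝ) :
    interaction d (c • σ) = c ^ 2 * interaction d σ := by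
  simp only [interaction, lintegral_smul_measure, smul_eq_mul]
  rw [lintegral_const_mul' _ _ hc, sq, mul_assoc]

/-- `U + V` equals its mean value almost everywhere for an equilibrium measure. -/
lemma IsEquilibrium.ae_eq (hd : 0 < d) {V : ℝ → ℝ≥0∞} (hV : Measurable V) {ρ : Measure ℝ}
    (hρ : IsEquilibrium d V ρ) (hfin : energy d V ρ ≠ ⊤) :
    ∀ᵐ y ∂ρ, potential d ρ y + V y = robin d V ρ := by
  have := hρ.1
  have hm : Measurable fun y => potential d ρ y + V y := (measurable_potential hd ρ).add hV
  have hF : robin d V ρ ≠ ⊤ := ne_top_of_le_ne_top hfin (robin_le_energy V ρ)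
  have hge : ∀ᵐ y ∂ρ, robin d V ρ ≤ potential d ρ y + V y := by
    let E := {y | potential d ρ y + V y < robin d V ρ}
    have hE : MeasurableSet E := hm measurableSet_Iio
    suffices h : ρ E = 0 by
      rw [ae_iff]; simpa only [not_le] using h
    by_contra hne
    have hinv : (ρ E)⁻¹ ≠ ⊤ := ENNReal.inv_ne_top.2 hne
    let σ := (ρ E)⁻¹ • ρ.restrict E
    have hσp : IsProbabilityMeasure σ := ⟨by
      simp [σ, ENNReal.inv_mul_cancel hne (measure_ne_top ρ E)]⟩
    obtain ⟨hA, hVρ⟩ := ENNReal.add_ne_top.1 hfin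
    have hVρ' : ∫⁻ x, V x ∂ρ ≠ ⊤ := fun h => hVρ (by simp [h])
    have hσ : energy d V σ ≠ ⊤ := by
      unfold energy
      refine ENNReal.add_ne_top.2 ⟨?_, ENNReal.mul_ne_top (by norm_num) ?_⟩
      · rw [interaction_smul hinv]
        exact ENNReal.mul_ne_top (ENNReal.pow_ne_top hinv)
          (ne_top_of_le_ne_top hA (interaction_mono Measure.restrict_le_self))
      · rw [lintegral_smul_measure]
        exact ENNReal.mul_ne_top hinv
          (ne_top_of_le_ne_top hVρ' (lintegral_mono' Measure.restrict_le_self le_rfl))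
    have h1 := hρ.robin_le_lintegral hd hfin σ hσ
    rw [← lintegral_add_left (measurable_potential hd ρ), lintegral_smul_measure,
      smul_eq_mul] at h1
    have h2 : ∫⁻ y in E, (potential d ρ y + V y) ∂ρ < ∫⁻ _ in E, robin d V ρ ∂ρ := by
      refine setLIntegral_strict_mono hE hne measurable_const ?_ (.of_forall fun y hy => hy)
      refine ne_top_of_le_ne_top hF ?_
      rw [robin_eq hd]
      exact lintegral_mono' Measure.restrict_le_self le_rfl
    rw [setLIntegral_const] at h2
    have h3 : (ρ E)⁻¹ * ∫⁻ y in E, (potential d ρ y + V y) ∂ρ <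
        (ρ E)⁻¹ * (robin d V ρ * ρ E) :=
      (ENNReal.mul_lt_mul_iff_right (ENNReal.inv_ne_zero.2 (measure_ne_top ρ E)) hinv).2 h2
    rw [mul_comm (robin d V ρ), ← mul_assoc, ENNReal.inv_mul_cancel hne (measure_ne_top ρ E),
      one_mul] at h3
    exact absurd h1 (not_le.2 h3)
  have := ae_eq_of_ae_le_of_lintegral_le hge (by simpa using hF) hm.aemeasurable (by
    rw [← robin_eq hd]; simp)
  filter_upwards [this] with y hy using hy.symm

/-- On the support of an equilibrium measure, `U + V` is at most its mean value. -/
lemma IsEquilibrium.le_robin (hd : 0 < d) {V : ℝ → ℝ≥0∞} (hV : LowerSemicontinuous V)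
    {ρ : Measure ℝ} (hρ : IsEquilibrium d V ρ) (hfin : energy d V ρ ≠ ⊤) {y : ℝ}
    (hy : y ∈ ρ.support) : potential d ρ y + V y ≤ robin d V ρ := by
  have := hρ.1
  by_contra hcon
  push Not at hcon
  have hopen : IsOpen {y | robin d V ρ < potential d ρ y + V y} :=
    ((lowerSemicontinuous_potential hd ρ).add hV).isOpen_preimage _
  have h1 := (Measure.mem_support_iff_forall y).1 hy _ (hopen.mem_nhds hcon)
  have h2 := hρ.ae_eq hd hV.measurable hfin
  rw [ae_iff] at h2
  refine h1.ne' (measure_mono_null (fun z hz => ?_) h2)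
  exact ne_of_gt hz

/-- Maximum principle: a potential which is at most `κ` on the support of its measure is at most
`κ` on the whole line. Outside the support this follows from the monotonicity, and in the gaps of
the support from the convexity, of the kernel on both half-lines. -/
lemma potential_le_of_support (hd : 0 < d) {σ : Measure ℝ} [IsProbabilityMeasure σ]
    {κ : ℝ≥0∞} (h : ∀ y ∈ σ.support, potential d σ y ≤ κ) (y : ℝ) : potential d σ y ≤ κ := by
  have hcl : IsClosed σ.support := Measure.isClosed_support
  have hae : ∀ᵐ x ∂σ, x ∈ σ.support := Measure.support_mem_ae
  have hne : σ.support.Nonempty := Measure.nonempty_support (IsProbabilityMeasure.ne_zero σ)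
  by_cases hy : y ∈ σ.support
  · exact h y hy
  -- the support points next to `y` on either side
  have hleft : (σ.support ∩ Set.Iic y).Nonempty → ∃ p ∈ σ.support, p < y ∧
      ∀ x ∈ σ.support, x ≤ y → x ≤ p := by
    intro hn
    have hb : BddAbove (σ.support ∩ Set.Iic y) := ⟨y, fun x hx => hx.2⟩
    have hm := (hcl.inter isClosed_Iic).csSup_mem hn hb
    refine ⟨_, hm.1, lt_of_le_of_ne hm.2 (fun e => hy (e ▸ hm.1)), fun x hx hxy => ?_⟩
    exact le_csSup hb ⟨hx, hxy⟩
  have hright : (σ.support ∩ Set.Ici y).Nonempty → ∃ q ∈ σ.support, y < q ∧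
      ∀ x ∈ σ.support, y ≤ x → q ≤ x := by
    intro hn
    have hb : BddBelow (σ.support ∩ Set.Ici y) := ⟨y, fun x hx => hx.2⟩
    have hm := (hcl.inter isClosed_Ici).csInf_mem hn hb
    refine ⟨_, hm.1, lt_of_le_of_ne hm.2 (fun e => hy (e ▸ hm.1)), fun x hx hxy => ?_⟩
    exact csInf_le hb ⟨hx, hxy⟩
  by_cases hL : (σ.support ∩ Set.Iic y).Nonempty
  · obtain ⟨p, hp, hpy, hpmax⟩ := hleft hL
    by_cases hR : (σ.support ∩ Set.Ici y).Nonempty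
    · obtain ⟨q, hq, hyq, hqmin⟩ := hright hR
      set a := (q - y) / (q - p) with ha
      set b := (y - p) / (q - p) with hb
      have hqp : 0 < q - p := by linarith
      have ha0 : 0 < a := div_pos (by linarith) hqp
      have hb0 : 0 < b := div_pos (by linarith) hqp
      have hab : a + b = 1 := by rw [ha, hb]; field_simp; ring
      have hyab : y = a * p + b * q := by rw [ha, hb]; field_simp; ring
      have h1 : potential d σ y ≤ ∫⁻ x, (ENNReal.ofReal a * kernel d (x - p) +
          ENNReal.ofReal b * kernel d (x - q)) ∂σ := by
        refine lintegral_mono_ae ?_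
        filter_upwards [hae] with x hx
        rcases le_total x y with hxy | hxy
        · have hxp := hpmax x hx hxy
          have := kernel_convex hd (x := p - x) (y := q - x) (by linarith) (by linarith)
            ha0 hb0 hab
          rw [kernel_sub_comm x y, kernel_sub_comm x p, kernel_sub_comm x q]
          refine le_of_eq_of_le ?_ this
          congr 1
          linear_combination hyab + x * hab
        · have hxq := hqmin x hx hxy
          have := kernel_convex hd (x := x - p) (y := x - q) (by linarith) (by linarith)
            ha0 hb0 hab
          refine le_of_eq_of_le ?_ this
          congr 1
          linear_combination -hyab - x * hab
      have hm : ∀ z, Measurable fun x => kernel d (x - z) := fun z =>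
        (measurable_kernel hd).comp (measurable_id.sub_const z)
      rw [lintegral_add_left ((hm p).const_mul _), lintegral_const_mul _ (hm p),
        lintegral_const_mul _ (hm q)] at h1
      calc potential d σ y ≤ _ := h1
        _ ≤ ENNReal.ofReal a * κ + ENNReal.ofReal b * κ := by
          gcongr
          · exact h p hp
          · exact h q hq
        _ = κ := by
          rw [← add_mul, ← ENNReal.ofReal_add ha0.le hb0.le, hab, ENNReal.ofReal_one, one_mul]
    · refine le_trans (lintegral_mono_ae ?_) (h p hp)
      filter_upwards [hae] with x hx
      have hxy : x ≤ y := by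
        by_contra hc
        exact hR ⟨x, hx, (not_le.1 hc).le⟩
      have hxp := hpmax x hx hxy
      refine kernel_anti hd ?_
      rw [abs_of_nonpos (by linarith), abs_of_nonpos (by linarith)]
      linarith
  · obtain ⟨z, hz⟩ := hne
    have hR : (σ.support ∩ Set.Ici y).Nonempty := ⟨z, hz, by
      by_contra hc
      exact hL ⟨z, hz, Set.mem_Iic.2 (not_le.1 hc).le⟩⟩
    obtain ⟨q, hq, hyq, hqmin⟩ := hright hR
    refine le_trans (lintegral_mono_ae ?_) (h q hq)
    filter_upwards [hae] with x hx
    have hxy : y ≤ x := by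
      by_contra hc
      exact hL ⟨x, hx, (not_le.1 hc).le⟩
    have hxq := hqmin x hx hxy
    refine kernel_anti hd ?_
    rw [abs_of_nonneg (by linarith), abs_of_nonneg (by linarith)]
    linarith

end

section

variable {d : ℝ} {w : ℂ → ℂ}

/-! ### Weight functions and their external fields -/

lemma isOpen_strip : IsOpen (strip d) :=
  isOpen_lt (Complex.continuous_im.abs) continuous_const

lemma ofReal_mem_strip (hd : 0 < d) (x : ℝ) : (x : ℂ) ∈ strip d := by simpa [strip] using hd

lemma ofReal_add_mem_strip {x : ℝ} {z : ℂ} : (x : ℂ) + z ∈ strip d ↔ z ∈ strip d := by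
  simp [strip]

/-- The mean value inequality on circles. -/
lemma two_pi_mul_enorm_le {f : ℂ → ℂ} {c : ℂ} {r : ℝ}
    (hf : DifferentiableOn ℂ f (Metric.closedBall c |r|)) :
    ENNReal.ofReal (2 * Real.pi) * ‖f c‖ₑ ≤
      ∫⁻ θ in Set.Ioo (-Real.pi) Real.pi, ‖f (c + r * (Real.cos θ + Real.sin θ * Complex.I))‖ₑ := by
  have hpi := Real.pi_pos
  have h1 : Real.circleAverage f c r = f c :=
    (hf.diffContOnCl_ball (le_refl _)).circleAverage
  rw [Real.circleAverage_eq_integral_add (-Real.pi), intervalIntegral.integral_comp_add_right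
    (fun θ => f (circleMap c r θ)), zero_add, show 2 * Real.pi + -Real.pi = Real.pi by ring] at h1
  have h2 : (2 * Real.pi) • f c = ∫ θ in (-Real.pi)..Real.pi, f (circleMap c r θ) := by
    rw [← h1, smul_smul, mul_inv_cancel₀ (by positivity), one_smul]
  have h3 : ‖(2 * Real.pi) • f c‖ₑ = ENNReal.ofReal (2 * Real.pi) * ‖f c‖ₑ := by
    rw [enorm_smul, Real.enorm_of_nonneg (by positivity)]
  rw [← h3, h2, intervalIntegral.integral_of_le (by linarith), integral_Ioc_eq_integral_Ioo]
  refine (enorm_integral_le_lintegral_enorm _).trans (le_of_eq ?_)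
  refine lintegral_congr fun θ => ?_
  rw [circleMap, Complex.exp_mul_I, Complex.ofReal_cos, Complex.ofReal_sin]

/-- The mean value inequality on discs: a function which is small in the mean over vertical
segments near `x` is small at `x`. -/
lemma enorm_le_of_vertical (hw : DifferentiableOn ℂ w (strip d)) {R x : ℝ} (hR : 0 < R)
    (hRd : R < d)
    {ε : ℝ≥0∞} (h : ∀ t ∈ Set.Icc (x - R) (x + R),
      ∫⁻ y in Set.Ioo (-d) d, ‖w (t + y * Complex.I)‖ₑ ≤ ε) :
    ENNReal.ofReal (2 * Real.pi) * ‖w x‖ₑ * (ENNReal.ofReal (R / 2) * ENNReal.ofReal (R / 2)) ≤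
      ε * ENNReal.ofReal (2 * R) := by
  have hpi := Real.pi_pos
  set G := (strip d).indicator w with hG
  have hGm : Measurable G := by
    classical
    have := hw.continuousOn.measurable_piecewise (g := fun _ => (0 : ℂ)) continuousOn_const
      isOpen_strip.measurableSet
    rwa [show (fun _ : ℂ => (0 : ℂ)) = 0 from rfl, Set.piecewise_eq_indicator] at this
  let f : ℂ → ℝ≥0∞ := {z : ℂ | |z.re| < R}.indicator fun z => ‖G (x + z)‖ₑ
  have hset : MeasurableSet {z : ℂ | |z.re| < R} :=
    (isOpen_lt Complex.continuous_re.abs continuous_const).measurableSet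
  have hfm : Measurable f := (hGm.comp (measurable_const_add _)).enorm.indicator hset
  -- the integral of `f` in Cartesian coordinates
  have hup : ∫⁻ z, f z ≤ ε * ENNReal.ofReal (2 * R) := by
    rw [← (Complex.volume_preserving_equiv_real_prod.symm).lintegral_comp hfm,
      Measure.volume_eq_prod, lintegral_prod _ (by fun_prop)]
    have h1 : ∀ s : ℝ, ∫⁻ y : ℝ, f (Complex.measurableEquivRealProd.symm (s, y)) ≤
        (Set.Icc (-R) R).indicator (fun _ => ε) s := by
      intro s
      by_cases hs : |s| < R
      · rw [Set.indicator_of_mem (Set.mem_Icc.2 (abs_le.1 hs.le))]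
        refine le_trans ?_ (h (x + s) ⟨by linarith [(abs_lt.1 hs).1], by linarith [(abs_lt.1 hs).2]⟩)
        rw [← lintegral_indicator measurableSet_Ioo]
        refine lintegral_mono fun y => ?_
        by_cases hy : |y| < d
        · have hz : (x : ℂ) + (⟨s, y⟩ : ℂ) ∈ strip d := by simpa [strip] using hy
          have e : (x : ℂ) + (⟨s, y⟩ : ℂ) = ((x + s : ℝ) : ℂ) + y * Complex.I := by
            apply Complex.ext <;> simp
          rw [Set.indicator_of_mem (Set.mem_Ioo.2 (abs_lt.1 hy))]
          simp only [f, Complex.measurableEquivRealProd_symm_apply]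
          rw [Set.indicator_of_mem (by simpa using hs), hG, Set.indicator_of_mem hz, e]
        · have hz : (x : ℂ) + (⟨s, y⟩ : ℂ) ∉ strip d := by simpa [strip] using hy
          simp only [f, Complex.measurableEquivRealProd_symm_apply]
          rw [Set.indicator_of_mem (by simpa using hs), hG, Set.indicator_of_notMem hz]
          simp
      · have : ∀ y : ℝ, f (Complex.measurableEquivRealProd.symm (s, y)) = 0 := fun y => by
          simp only [f, Complex.measurableEquivRealProd_symm_apply]
          rw [Set.indicator_of_notMem (by simpa using hs)]
        rw [lintegral_congr this, lintegral_zero]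
        exact zero_le
    refine (lintegral_mono h1).trans ?_
    rw [lintegral_indicator measurableSet_Icc, setLIntegral_const, Real.volume_Icc]
    gcongr
    exact le_of_eq (by ring)
  -- the integral of `f` in polar coordinates
  refine le_trans ?_ hup
  rw [← Complex.lintegral_comp_polarCoord_symm]
  have hsub : Set.Ioo (R / 2) R ×ˢ Set.Ioo (-Real.pi) Real.pi ⊆ polarCoord.target := by
    rintro ⟨r, θ⟩ ⟨hr, hθ⟩
    exact ⟨(by linarith [hr.1] : (0 : ℝ) < r), hθ⟩
  refine le_trans ?_ (lintegral_mono_set hsub)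
  have hm : Measurable fun p : ℝ × ℝ => ENNReal.ofReal p.1 • f (Complex.polarCoord.symm p) := by
    simp only [Complex.polarCoord_symm_apply, smul_eq_mul]
    exact (measurable_fst.ennreal_ofReal).mul (hfm.comp (by fun_prop))
  rw [Measure.volume_eq_prod, setLIntegral_prod _ hm.aemeasurable]
  have h2 : ∀ r ∈ Set.Ioo (R / 2) R, ENNReal.ofReal (2 * Real.pi) * ‖w x‖ₑ * ENNReal.ofReal (R / 2) ≤
      ∫⁻ θ in Set.Ioo (-Real.pi) Real.pi,
        ENNReal.ofReal (r, θ).1 • f (Complex.polarCoord.symm (r, θ)) := by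
    intro r hr
    have hr0 : 0 < r := by linarith [hr.1]
    have hball : Metric.closedBall (x : ℂ) |r| ⊆ strip d := by
      intro z hz
      have h3 : |(z - x).im| ≤ ‖z - x‖ := Complex.abs_im_le_norm _
      rw [Metric.mem_closedBall, dist_eq_norm, abs_of_pos hr0] at hz
      have h4 : (z - x).im = z.im := by simp
      rw [h4] at h3
      exact h3.trans_lt (hz.trans_lt (hr.2.trans hRd))
    have h5 := two_pi_mul_enorm_le (hw.mono hball)
    have h6 : ∀ θ : ℝ, f (Complex.polarCoord.symm (r, θ)) =
        ‖w (x + r * (Real.cos θ + Real.sin θ * Complex.I))‖ₑ := by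
      intro θ
      rw [Complex.polarCoord_symm_apply]
      have hn : ‖(r : ℂ) * (Real.cos θ + Real.sin θ * Complex.I)‖ = r := by
        rw [norm_mul, Complex.norm_real, Real.norm_of_nonneg hr0.le, Complex.ofReal_cos,
          Complex.ofReal_sin, Complex.norm_cos_add_sin_mul_I, mul_one]
      have hre : |((r : ℂ) * (Real.cos θ + Real.sin θ * Complex.I)).re| < R :=
        (Complex.abs_re_le_norm _).trans_lt (hn.trans_lt hr.2)
      have hmem : (x : ℂ) + (r : ℂ) * (Real.cos θ + Real.sin θ * Complex.I) ∈ strip d := by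
        apply hball
        rw [Metric.mem_closedBall, dist_eq_norm, add_sub_cancel_left, hn, abs_of_pos hr0]
      simp only [f]
      rw [Set.indicator_of_mem (by exact hre), hG, Set.indicator_of_mem hmem]
    simp only [h6, smul_eq_mul]
    rw [lintegral_const_mul' _ _ ENNReal.ofReal_ne_top, mul_comm _ (ENNReal.ofReal (R / 2))]
    exact mul_le_mul' (ENNReal.ofReal_le_ofReal hr.1.le) h5
  calc _ = ∫⁻ _ in Set.Ioo (R / 2) R, ENNReal.ofReal (2 * Real.pi) * ‖w x‖ₑ * ENNReal.ofReal (R / 2) := by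
        rw [setLIntegral_const, Real.volume_Ioo, mul_assoc _ _ (ENNReal.ofReal (R - R / 2))]
        congr 3
        ring
    _ ≤ _ := setLIntegral_mono' measurableSet_Ioo h2

/-- Decay of `w` on the real line in a direction in which its vertical integrals decay. -/
lemma tendsto_enorm_of_vertical (hd : 0 < d) (hw : DifferentiableOn ℂ w (strip d)) {l : Filter ℝ}
    (hl : ∀ (P : ℝ → Prop), (∀ᶠ t in l, P t) →
      ∀ᶠ x in l, ∀ t ∈ Set.Icc (x - d / 2) (x + d / 2), P t)
    (h : Tendsto (fun x : ℝ => ∫⁻ y in Set.Ioo (-d) d, ‖w (x + y * Complex.I)‖ₑ) l (𝓝 0)) :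
    Tendsto (fun x : ℝ => ‖w x‖ₑ) l (𝓝 0) := by
  have hpi := Real.pi_pos
  set c : ℝ≥0∞ := ENNReal.ofReal (2 * Real.pi) * (ENNReal.ofReal (d / 2 / 2) * ENNReal.ofReal (d / 2 / 2))
    with hc
  have hc0 : c ≠ 0 := by simp only [hc, ne_eq, mul_eq_zero, ENNReal.ofReal_eq_zero]; grind
  have hct : c ≠ ⊤ := ENNReal.mul_ne_top ENNReal.ofReal_ne_top
    (ENNReal.mul_ne_top ENNReal.ofReal_ne_top ENNReal.ofReal_ne_top)
  have hb0 : ENNReal.ofReal (2 * (d / 2)) ≠ 0 := by simp only [ne_eq, ENNReal.ofReal_eq_zero]; linarith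
  rw [ENNReal.tendsto_nhds_zero] at h ⊢
  intro ε hε
  have hδ : 0 < ε * c / ENNReal.ofReal (2 * (d / 2)) :=
    ENNReal.div_pos (mul_ne_zero hε.ne' hc0) ENNReal.ofReal_ne_top
  filter_upwards [hl _ (h _ hδ)] with x hx
  have h1 := enorm_le_of_vertical hw (half_pos hd) (half_lt_self hd) hx
  rw [ENNReal.div_mul_cancel hb0 ENNReal.ofReal_ne_top, mul_right_comm, ← hc, mul_comm ε] at h1
  exact (ENNReal.mul_le_mul_iff_right hc0 hct).1 h1

lemma IsWeight.differentiableOn (hw : IsWeight d w) : DifferentiableOn ℂ w (strip d) :=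
  hw.analytic.differentiableOn

lemma IsWeight.ofReal_re (hw : IsWeight d w) (x : ℝ) : (((w x).re : ℝ) : ℂ) = w x := by
  apply Complex.ext
  · simp
  · simp [(hw.real_values x).1]

lemma IsWeight.norm_eq (hw : IsWeight d w) (x : ℝ) : ‖w x‖ = (w x).re := by
  rw [← hw.ofReal_re, Complex.norm_real, Complex.ofReal_re,
    Real.norm_of_nonneg (hw.real_values x).2.1.le]

lemma IsWeight.exp_neg_field (hw : IsWeight d w) (x : ℝ) : Real.exp (-field w x) = (w x).re := by
  rw [field, neg_neg, Real.exp_log (hw.real_values x).2.1]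

lemma IsWeight.field_nonneg (hw : IsWeight d w) (x : ℝ) : 0 ≤ field w x :=
  neg_nonneg.2 (Real.log_nonpos (hw.real_values x).2.1.le (hw.real_values x).2.2)

lemma IsWeight.convexOn_field (hw : IsWeight d w) : ConvexOn ℝ Set.univ (field w) :=
  hw.log_strictConcave.concaveOn.neg

lemma IsWeight.continuous_field (hw : IsWeight d w) : Continuous (field w) :=
  continuousOn_univ.1 (hw.convexOn_field.continuousOn isOpen_univ)

lemma IsWeight.tendsto_field (hw : IsWeight d w) {l : Filter ℝ}
    (h : Tendsto (fun x : ℝ => ‖w x‖ₑ) l (𝓝 0)) : Tendsto (field w) l atTop := by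
  have h1 : Tendsto (fun x : ℝ => (w x).re) l (𝓝 0) := by
    have h2 := (ENNReal.tendsto_toReal ENNReal.zero_ne_top).comp h
    refine h2.congr fun x => ?_
    simp [hw.norm_eq]
  have h3 : Tendsto (fun x : ℝ => (w x).re) l (𝓝[>] 0) :=
    tendsto_nhdsWithin_iff.2 ⟨h1, .of_forall fun x => (hw.real_values x).2.1⟩
  exact tendsto_neg_atBot_atTop.comp (Real.tendsto_log_nhdsGT_zero.comp h3)

/-- The external field of a weight function is confining. -/
lemma IsWeight.exists_le_field (hd : 0 < d) (hw : IsWeight d w) (M : ℝ) :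
    ∃ R : ℝ, ∀ x, R < |x| → M ≤ field w x := by
  have h1 : Tendsto (field w) atTop atTop := hw.tendsto_field <|
    tendsto_enorm_of_vertical hd hw.differentiableOn (fun P hP => by
      obtain ⟨A, hA⟩ := eventually_atTop.1 hP
      exact eventually_atTop.2 ⟨A + d / 2, fun x hx t ht => hA t (by linarith [ht.1])⟩)
      hw.vertical_atTop
  have h2 : Tendsto (field w) atBot atTop := hw.tendsto_field <|
    tendsto_enorm_of_vertical hd hw.differentiableOn (fun P hP => by
      obtain ⟨A, hA⟩ := eventually_atBot.1 hP
      exact eventually_atBot.2 ⟨A - d / 2, fun x hx t ht => hA t (by linarith [ht.2])⟩)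
      hw.vertical_atBot
  obtain ⟨A, hA⟩ := eventually_atTop.1 (h1.eventually_ge_atTop M)
  obtain ⟨B, hB⟩ := eventually_atBot.1 (h2.eventually_ge_atTop M)
  refine ⟨max A (-B), fun x hx => ?_⟩
  rcases lt_abs.1 hx with h | h
  · exact hA x ((le_max_left _ _).trans h.le)
  · exact hB x (by linarith [(le_max_right A (-B)).trans h.le])

end

section

variable {d : ℝ} {w : ℂ → ℂ}

/-! ### Duality: potentials never exceed the equilibrium constant -/

/-- The hard constraint to a closed set `S`, written as an external field. -/
noncomputable def hardWall (S : Set ℝ) : ℝ → ℝ≥0∞ := Sᶜ.indicator fun _ => ⊤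

lemma hardWall_eq_iSup {S : Set ℝ} (hS : IsClosed S) :
    hardWall S = fun x => ⨆ k : ℕ, (k : ℝ≥0∞) * Metric.infEDist x S := by
  ext x
  by_cases hx : x ∈ S
  · simp [hardWall, hx, Metric.infEDist_zero_of_mem hx]
  · have h0 : Metric.infEDist x S ≠ 0 := fun h =>
      hx (by rwa [Metric.mem_iff_infEDist_zero_of_closed hS])
    simp [hardWall, hx, ← ENNReal.iSup_mul, ENNReal.iSup_natCast, ENNReal.top_mul h0]

lemma lintegral_hardWall {S : Set ℝ} (hS : IsClosed S) (σ : Measure ℝ) :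
    ∫⁻ x, hardWall S x ∂σ = ⊤ * σ Sᶜ := by
  rw [hardWall, lintegral_indicator_const hS.isOpen_compl.measurableSet]

lemma lowerSemicontinuous_lintegral_hardWall {S : Set ℝ} (hS : IsClosed S) :
    LowerSemicontinuous fun σ : ProbabilityMeasure ℝ => ∫⁻ x, hardWall S x ∂(σ : Measure ℝ) := by
  have hc : ∀ k : ℕ, Continuous fun x : ℝ => (k : ℝ≥0∞) * Metric.infEDist x S := fun k =>
    (ENNReal.continuous_const_mul (ENNReal.natCast_ne_top k)).comp Metric.continuous_infEDist
  have h : ∀ σ : ProbabilityMeasure ℝ, ∫⁻ x, hardWall S x ∂(σ : Measure ℝ) =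
      ⨆ k : ℕ, ∫⁻ x, (k : ℝ≥0∞) * Metric.infEDist x S ∂(σ : Measure ℝ) := by
    intro σ
    rw [← lintegral_iSup (fun k => (hc k).measurable)
      (fun i j hij x => mul_le_mul' (by exact_mod_cast hij) le_rfl), hardWall_eq_iSup hS]
  simp_rw [h]
  exact lowerSemicontinuous_iSup fun k => lowerSemicontinuous_lintegral_of_continuous (hc k)

/-- The equilibrium constant of `(K, V)` dominates `inf (U^ν + V)` for every probability measure
`ν`. The proof integrates against the equilibrium measure `ω` of the support of `ρ`: the potential
of `ω` is at most its Robin constant everywhere by the maximum principle, and at least that constant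
in the mean with respect to `ρ`. -/
lemma IsEquilibrium.le_robin_of_le_potential (hd : 0 < d) {V : ℝ → ℝ≥0∞}
    (hV : LowerSemicontinuous V) (hVinf : ∀ M : ℝ≥0, ∃ R : ℝ, ∀ x, R < |x| → (M : ℝ≥0∞) ≤ V x)
    {ρ : Measure ℝ} (hρ : IsEquilibrium d V ρ) (hfin : energy d V ρ ≠ ⊤) (ν : Measure ℝ)
    [IsProbabilityMeasure ν] {c : ℝ≥0∞} (hc : ∀ x, c ≤ potential d ν x + V x) :
    c ≤ robin d V ρ := by
  have := hρ.1
  have hF : robin d V ρ ≠ ⊤ := ne_top_of_le_ne_top hfin (robin_le_energy V ρ)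
  set S := ρ.support with hS
  have hScl : IsClosed S := Measure.isClosed_support
  have hle : ∀ y ∈ S, potential d ρ y + V y ≤ robin d V ρ := fun y hy => hρ.le_robin hd hV hfin hy
  -- the support is bounded
  obtain ⟨R, hR⟩ := hVinf ((robin d V ρ).toNNReal + 1)
  have hSR : ∀ x, R < |x| → x ∉ S := by
    intro x hx hxS
    have h1 := (hR x hx).trans (le_add_self.trans (hle x hxS))
    rw [ENNReal.coe_add, ENNReal.coe_toNNReal hF] at h1
    exact absurd h1 (not_le.2 (ENNReal.lt_add_right hF (by simp)))
  obtain ⟨ω, hω⟩ := exists_isEquilibrium hd (V := hardWall S)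
    (measurable_const.indicator hScl.isOpen_compl.measurableSet)
    (lowerSemicontinuous_lintegral_hardWall hScl)
    (fun M => ⟨R, fun x hx => by simp [hardWall, hSR x hx]⟩)
  have := hω.1
  have hρS : ∫⁻ x, hardWall S x ∂ρ = 0 := by
    rw [lintegral_hardWall hScl, hS, Measure.measure_compl_support, mul_zero]
  have hρfin : energy d (hardWall S) ρ ≠ ⊤ := by
    rw [energy, hρS, mul_zero, add_zero]
    exact (ENNReal.add_ne_top.1 hfin).1
  have hωfin : energy d (hardWall S) ω ≠ ⊤ := ne_top_of_le_ne_top hρfin (hω.2 ρ hρ.1)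
  have hωS : ω Sᶜ = 0 := by
    by_contra h
    have h1 := (ENNReal.add_ne_top.1 hωfin).2
    rw [lintegral_hardWall hScl, ENNReal.top_mul h] at h1
    simp at h1
  set κ := robin d (hardWall S) ω with hκ
  have hup : ∀ y, potential d ω y ≤ κ := potential_le_of_support hd fun y hy =>
    le_self_add.trans (hω.le_robin hd
      (hScl.isOpen_compl.lowerSemicontinuous_indicator zero_le) hωfin hy)
  have hlow : κ ≤ ∫⁻ y, potential d ω y ∂ρ := by
    have := hω.robin_le_lintegral hd hωfin ρ hρfin
    rwa [hρS, add_zero] at this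
  calc c = ∫⁻ _, c ∂ω := by simp
    _ ≤ ∫⁻ x, (potential d ν x + V x) ∂ω := lintegral_mono hc
    _ = ∫⁻ x, potential d ω x ∂ν + ∫⁻ x, V x ∂ω := by
      rw [lintegral_add_left (measurable_potential hd ν), lintegral_potential_comm hd]
    _ ≤ κ + ∫⁻ x, V x ∂ω := by
      gcongr
      exact (lintegral_mono hup).trans (by simp)
    _ ≤ ∫⁻ x, potential d ρ x ∂ω + ∫⁻ x, V x ∂ω := by
      gcongr
      rwa [lintegral_potential_comm hd]
    _ = ∫⁻ x, (potential d ρ x + V x) ∂ω := (lintegral_add_left (measurable_potential hd ρ) _).symm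
    _ ≤ ∫⁻ _, robin d V ρ ∂ω := by
      refine lintegral_mono_ae ?_
      filter_upwards [compl_mem_ae_iff.2 hωS] with y hy
      exact hle y (not_not.1 hy)
    _ = robin d V ρ := by simp

/-! ### Measures of total mass `n` -/

/-- The external field seen by a probability measure after rescaling a measure of mass `n`. -/
noncomputable def scaledField (w : ℂ → ℂ) (n : ℕ) (x : ℝ) : ℝ≥0∞ :=
  (n : ℝ≥0∞)⁻¹ * ENNReal.ofReal (field w x)

variable {n : ℕ}

lemma natCast_inv_ne_top (hn : n ≠ 0) : (n : ℝ≥0∞)⁻¹ ≠ ⊤ :=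
  ENNReal.inv_ne_top.2 (by exact_mod_cast hn)

lemma natCast_mul_inv_cancel (hn : n ≠ 0) : (n : ℝ≥0∞) * (n : ℝ≥0∞)⁻¹ = 1 :=
  ENNReal.mul_inv_cancel (by exact_mod_cast hn) (ENNReal.natCast_ne_top n)

lemma IsWeight.continuous_scaledField (hw : IsWeight d w) (hn : n ≠ 0) :
    Continuous (scaledField w n) :=
  (ENNReal.continuous_const_mul (natCast_inv_ne_top hn)).comp
    (ENNReal.continuous_ofReal.comp hw.continuous_field)

lemma IsWeight.exists_le_scaledField (hd : 0 < d) (hw : IsWeight d w) (hn : n ≠ 0) (M : ℝ≥0) :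
    ∃ R : ℝ, ∀ x, R < |x| → (M : ℝ≥0∞) ≤ scaledField w n x := by
  obtain ⟨R, hR⟩ := hw.exists_le_field hd (n * M)
  refine ⟨R, fun x hx => ?_⟩
  have h1 : (n : ℝ≥0∞) * M ≤ ENNReal.ofReal (field w x) := by
    refine le_of_eq_of_le ?_ (ENNReal.ofReal_le_ofReal (hR x hx))
    rw [ENNReal.ofReal_mul (by positivity), ENNReal.ofReal_natCast, ENNReal.ofReal_coe_nnreal]
  calc (M : ℝ≥0∞) = (n : ℝ≥0∞)⁻¹ * (n * M) := by
        rw [← mul_assoc, mul_comm _ (n : ℝ≥0∞), natCast_mul_inv_cancel hn, one_mul]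
    _ ≤ _ := mul_le_mul' le_rfl h1

lemma lintegral_field_smul (hn : n ≠ 0) (ρ : Measure ℝ) :
    fieldEnergy w ((n : ℝ≥0∞) • ρ) = (n : ℝ≥0∞) ^ 2 * ∫⁻ x, scaledField w n x ∂ρ := by
  simp only [fieldEnergy, scaledField]
  rw [lintegral_smul_measure, lintegral_const_mul' _ _ (natCast_inv_ne_top hn), smul_eq_mul, sq,
    mul_assoc, ← mul_assoc (n : ℝ≥0∞) (n : ℝ≥0∞)⁻¹, natCast_mul_inv_cancel hn, one_mul]

lemma contEnergy_smul (hn : n ≠ 0) (ρ : Measure ℝ) :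
    contEnergy d w ((n : ℝ≥0∞) • ρ) = (n : ℝ≥0∞) ^ 2 * energy d (scaledField w n) ρ := by
  rw [contEnergy, lintegral_field_smul hn, interaction_smul (ENNReal.natCast_ne_top n), energy]
  ring

lemma contF_smul (hn : n ≠ 0) (ρ : Measure ℝ) :
    contF d w ((n : ℝ≥0∞) • ρ) = (n : ℝ≥0∞) ^ 2 * robin d (scaledField w n) ρ := by
  rw [contF, lintegral_field_smul hn, interaction_smul (ENNReal.natCast_ne_top n), robin]
  ring

lemma natCast_smul_inv_smul (hn : n ≠ 0) (μ : Measure ℝ) :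
    (n : ℝ≥0∞) • ((n : ℝ≥0∞)⁻¹ • μ) = μ := by
  rw [smul_smul, natCast_mul_inv_cancel hn, one_smul]

lemma isProbabilityMeasure_inv_smul (hn : n ≠ 0) {μ : Measure ℝ} (hμ : μ Set.univ = n) :
    IsProbabilityMeasure ((n : ℝ≥0∞)⁻¹ • μ) :=
  ⟨by rw [Measure.smul_apply, hμ, smul_eq_mul, mul_comm, natCast_mul_inv_cancel hn]⟩

lemma natCast_sq_mul_le_iff (hn : n ≠ 0) {a b : ℝ≥0∞} :
    (n : ℝ≥0∞) ^ 2 * a ≤ (n : ℝ≥0∞) ^ 2 * b ↔ a ≤ b :=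
  ENNReal.mul_le_mul_iff_right (pow_ne_zero _ (by exact_mod_cast hn))
    (ENNReal.pow_ne_top (ENNReal.natCast_ne_top n))

lemma IsContMinimizer.isEquilibrium (hn : n ≠ 0) {μ : Measure ℝ} (hμ : IsContMinimizer d w n μ) :
    IsEquilibrium d (scaledField w n) ((n : ℝ≥0∞)⁻¹ • μ) := by
  refine ⟨isProbabilityMeasure_inv_smul hn hμ.1, fun σ hσ => ?_⟩
  rw [← natCast_sq_mul_le_iff hn, ← contEnergy_smul hn, ← contEnergy_smul hn,
    natCast_smul_inv_smul hn]
  exact hμ.2 _ (by simp)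

/-- The continuous energy attains its minimum. -/
lemma IsWeight.exists_isContMinimizer (hd : 0 < d) (hw : IsWeight d w) (hn : n ≠ 0) :
    ∃ μ, IsContMinimizer d w n μ := by
  have hc := hw.continuous_scaledField hn
  obtain ⟨ρ, hρ⟩ := exists_isEquilibrium hd hc.measurable
    (lowerSemicontinuous_lintegral_of_continuous hc) (hw.exists_le_scaledField hd hn)
  have := hρ.1
  refine ⟨(n : ℝ≥0∞) • ρ, by simp, fun ν hν => ?_⟩
  rw [← natCast_smul_inv_smul hn ν, contEnergy_smul hn, contEnergy_smul hn,
    natCast_sq_mul_le_iff hn]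
  exact hρ.2 _ (isProbabilityMeasure_inv_smul hn hν)

/-- Duality for point configurations: for points `b j` with multiplicities `m j` of total `n`, the
infimum of `∑ m_j K(· - b_j) + Q` is at most `F / n`, where `F` belongs to any minimizer of the
continuous energy. -/
lemma IsContMinimizer.mul_le_contF (hd : 0 < d) (hw : IsWeight d w) (hn : n ≠ 0) {μ : Measure ℝ}
    (hμ : IsContMinimizer d w n μ) (hfin : contEnergy d w μ ≠ ⊤) {ι : Type*} [Fintype ι]
    (m : ι → ℕ) (hm : ∑ j, m j = n) (b : ι → ℝ) {c : ℝ≥0∞}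
    (hc : ∀ x, c ≤ ∑ j, (m j : ℝ≥0∞) * kernel d (x - b j) + ENNReal.ofReal (field w x)) :
    (n : ℝ≥0∞) * c ≤ contF d w μ := by
  have hn2 : (n : ℝ≥0∞) ^ 2 ≠ 0 := pow_ne_zero _ (by exact_mod_cast hn)
  have hρ := hμ.isEquilibrium hn
  rw [← natCast_smul_inv_smul hn μ, contEnergy_smul hn] at hfin
  have hfin' : energy d (scaledField w n) ((n : ℝ≥0∞)⁻¹ • μ) ≠ ⊤ := fun h =>
    hfin (by rw [h, ENNReal.mul_top hn2])
  let ν : Measure ℝ := ∑ j, (m j : ℝ≥0∞) • Measure.dirac (b j)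
  have hν : ν Set.univ = n := by
    simp [ν, ← hm]
  have := isProbabilityMeasure_inv_smul hn hν
  have h := hρ.le_robin_of_le_potential hd (hw.continuous_scaledField hn).lowerSemicontinuous
    (hw.exists_le_scaledField hd hn) hfin' ((n : ℝ≥0∞)⁻¹ • ν) (c := (n : ℝ≥0∞)⁻¹ * c) (by
      intro x
      have h1 : potential d ((n : ℝ≥0∞)⁻¹ • ν) x =
          (n : ℝ≥0∞)⁻¹ * ∑ j, (m j : ℝ≥0∞) * kernel d (x - b j) := by
        simp [potential, ν, lintegral_smul_measure, lintegral_finsetSum_measure,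
          kernel_sub_comm x]
      rw [h1, scaledField, ← mul_add]
      exact mul_le_mul' le_rfl (hc x))
  have h2 : contF d w μ = (n : ℝ≥0∞) ^ 2 * robin d (scaledField w n) ((n : ℝ≥0∞)⁻¹ • μ) := by
    rw [← contF_smul hn, natCast_smul_inv_smul hn]
  rw [h2]
  calc (n : ℝ≥0∞) * c = (n : ℝ≥0∞) ^ 2 * ((n : ℝ≥0∞)⁻¹ * c) := by
        rw [sq, mul_assoc, ← mul_assoc (n : ℝ≥0∞) (n : ℝ≥0∞)⁻¹, natCast_mul_inv_cancel hn, one_mul]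
    _ ≤ _ := mul_le_mul' le_rfl h

end

section

variable {d : ℝ} {w : ℂ → ℂ} {n : ℕ}

/-! ### The discrete energy -/

/-- The diagonal terms may be added, because `kernelReal d 0 = -log 0 = 0`. -/
lemma sum_erase_kernelReal (a : Fin n → ℝ) (i : Fin n) :
    ∑ j ∈ Finset.univ.erase i, kernelReal d (a i - a j) = ∑ j, kernelReal d (a i - a j) := by
  rw [← Finset.add_sum_erase _ _ (Finset.mem_univ i), sub_self, kernelReal_zero, zero_add]

lemma discEnergy_eq (a : Fin n → ℝ) : discEnergy d w a =
    (∑ i, ∑ j, kernelReal d (a i - a j)) + 2 * ((n : ℝ) - 1) / n * ∑ i, field w (a i) := by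
  simp only [discEnergy, sum_erase_kernelReal]

lemma discF_eq (a : Fin n → ℝ) : discF d w a =
    (∑ i, ∑ j, kernelReal d (a i - a j)) + ((n : ℝ) - 1) / n * ∑ i, field w (a i) := by
  rw [discF, discEnergy_eq]
  ring

lemma discEnergy_comp_perm (a : Fin n → ℝ) (σ : Equiv.Perm (Fin n)) :
    discEnergy d w (a ∘ σ) = discEnergy d w a := by
  simp only [discEnergy_eq, Function.comp]
  rw [Equiv.sum_comp σ (fun i => field w (a i)),
    Equiv.sum_comp σ (fun i => ∑ j, kernelReal d (a i - a (σ j)))]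
  congr 1
  exact Finset.sum_congr rfl fun i _ => Equiv.sum_comp σ (fun j => kernelReal d (a i - a j))

lemma IsDiscMinimizer.le_of_injective {a b : Fin n → ℝ} (ha : IsDiscMinimizer d w a)
    (hb : Function.Injective b) : discEnergy d w a ≤ discEnergy d w b := by
  rw [← discEnergy_comp_perm b (Tuple.sort b)]
  exact ha.2 _ ((Tuple.monotone_sort b).strictMono_of_injective
    (hb.comp (Tuple.sort b).injective))

/-- The terms of the discrete energy that involve a given index. -/
lemma sum_kernelReal_split (b : Fin n → ℝ) (i : Fin n) :
    ∑ p, ∑ q, kernelReal d (b p - b q) = 2 * ∑ q ∈ Finset.univ.erase i, kernelReal d (b i - b q) +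
      ∑ p ∈ Finset.univ.erase i, ∑ q ∈ Finset.univ.erase i, kernelReal d (b p - b q) := by
  rw [← Finset.add_sum_erase _ _ (Finset.mem_univ i), ← sum_erase_kernelReal]
  have h : ∀ p ∈ Finset.univ.erase i, ∑ q, kernelReal d (b p - b q) =
      kernelReal d (b i - b p) + ∑ q ∈ Finset.univ.erase i, kernelReal d (b p - b q) := by
    intro p _
    rw [← Finset.add_sum_erase _ _ (Finset.mem_univ i), kernelReal_sub_comm]
  rw [Finset.sum_congr rfl h, Finset.sum_add_distrib]
  ring

/-- Moving the `i`-th point of a minimizer does not decrease the energy. -/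
lemma IsDiscMinimizer.le_of_update {a : Fin n → ℝ} (ha : IsDiscMinimizer d w a) {x : ℝ}
    (hx : x ∉ Set.range a) (i : Fin n) :
    2 * ∑ j, kernelReal d (a i - a j) + 2 * ((n : ℝ) - 1) / n * field w (a i) ≤
      2 * (∑ j, kernelReal d (x - a j) - kernelReal d (x - a i)) +
        2 * ((n : ℝ) - 1) / n * field w x := by
  have hinj : Function.Injective (Function.update a i x) := by
    intro p q hpq
    simp only [Function.update_apply] at hpq
    split_ifs at hpq with h1 h2 h2
    · rw [h1, h2]
    · exact absurd ⟨q, hpq.symm⟩ hx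
    · exact absurd ⟨p, hpq⟩ hx
    · exact ha.1.injective hpq
  have h := ha.le_of_injective hinj
  rw [discEnergy_eq, discEnergy_eq, sum_kernelReal_split _ i,
    sum_kernelReal_split (Function.update a i x) i,
    ← Finset.add_sum_erase _ _ (Finset.mem_univ i),
    ← Finset.add_sum_erase _ (fun p => field w (Function.update a i x p)) (Finset.mem_univ i)] at h
  have e : ∀ p ∈ Finset.univ.erase i, Function.update a i x p = a p := fun p hp =>
    Function.update_of_ne (Finset.ne_of_mem_erase hp) _ _
  have e1 : ∑ q ∈ Finset.univ.erase i,
      kernelReal d (Function.update a i x i - Function.update a i x q) =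
      ∑ q ∈ Finset.univ.erase i, kernelReal d (x - a q) :=
    Finset.sum_congr rfl fun q hq => by rw [e q hq, Function.update_self]
  have e2 : ∑ p ∈ Finset.univ.erase i, ∑ q ∈ Finset.univ.erase i,
      kernelReal d (Function.update a i x p - Function.update a i x q) =
      ∑ p ∈ Finset.univ.erase i, ∑ q ∈ Finset.univ.erase i, kernelReal d (a p - a q) :=
    Finset.sum_congr rfl fun p hp => Finset.sum_congr rfl fun q hq => by rw [e q hq, e p hp]
  have e3 : ∑ p ∈ Finset.univ.erase i, field w (Function.update a i x p) =
      ∑ p ∈ Finset.univ.erase i, field w (a p) :=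
    Finset.sum_congr rfl fun p hp => by rw [e p hp]
  rw [e1, e2, e3, Function.update_self, sum_erase_kernelReal] at h
  have h4 := Finset.add_sum_erase Finset.univ (fun q => kernelReal d (x - a q)) (Finset.mem_univ i)
  rw [← h4]
  linarith

/-- The discrete analogue of the Frostman condition, obtained by summing the optimality conditions
of the single points. -/
lemma IsDiscMinimizer.discF_le (hn : 2 ≤ n) {a : Fin n → ℝ} (ha : IsDiscMinimizer d w a) {x : ℝ}
    (hx : x ∉ Set.range a) :
    discF d w a / ((n : ℝ) - 1) ≤ ∑ j, kernelReal d (x - a j) + field w x := by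
  have hn' : (2 : ℝ) ≤ n := by exact_mod_cast hn
  have h := Finset.sum_le_sum fun i (_ : i ∈ Finset.univ) => ha.le_of_update hx i
  rw [Finset.sum_add_distrib, Finset.sum_add_distrib, ← Finset.mul_sum, ← Finset.mul_sum,
    ← Finset.mul_sum, Finset.sum_sub_distrib, Finset.sum_const, Finset.card_univ, Fintype.card_fin,
    Finset.sum_const, Finset.card_univ, Fintype.card_fin, nsmul_eq_mul, nsmul_eq_mul] at h
  rw [discF_eq, div_le_iff₀ (by linarith)]
  have e : (n : ℝ) * (2 * ((n : ℝ) - 1) / n * field w x) = 2 * ((n - 1) * field w x) := by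
    field_simp
  have e2 : 2 * ((n : ℝ) - 1) / n * ∑ i, field w (a i) =
      2 * (((n : ℝ) - 1) / n * ∑ i, field w (a i)) := by ring
  rw [e, e2] at h
  linarith

/-- The same condition with values in `[0, ∞]`, valid also at the nodes. -/
lemma IsDiscMinimizer.ofReal_discF_le (hw : IsWeight d w) (hn : 2 ≤ n)
    {a : Fin n → ℝ} (ha : IsDiscMinimizer d w a) (x : ℝ) :
    ENNReal.ofReal (discF d w a / ((n : ℝ) - 1)) ≤
      ∑ j, kernel d (x - a j) + ENNReal.ofReal (field w x) := by
  by_cases hx : x ∈ Set.range a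
  · obtain ⟨j, rfl⟩ := hx
    have : kernel d (a j - a j) ≤ ∑ i, kernel d (a j - a i) :=
      Finset.single_le_sum (f := fun i => kernel d (a j - a i)) (fun _ _ => zero_le)
        (Finset.mem_univ j)
    rw [sub_self, kernel_zero, top_le_iff] at this
    simp [this]
  · have h1 : ∀ j, kernel d (x - a j) = ENNReal.ofReal (kernelReal d (x - a j)) := fun j =>
      kernel_of_ne fun h => hx ⟨j, (sub_eq_zero.1 h).symm⟩
    simp_rw [h1]
    rw [← ENNReal.ofReal_sum_of_nonneg fun j _ => kernelReal_nonneg _, ← ENNReal.ofReal_add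
      (Finset.sum_nonneg fun j _ => kernelReal_nonneg _) (hw.field_nonneg x)]
    exact ENNReal.ofReal_le_ofReal (ha.discF_le hn hx)

lemma discF_nonneg (hw : IsWeight d w) (hn : 1 ≤ n) (a : Fin n → ℝ) : 0 ≤ discF d w a := by
  have hn' : (1 : ℝ) ≤ n := by exact_mod_cast hn
  rw [discF_eq]
  refine add_nonneg (Finset.sum_nonneg fun i _ => Finset.sum_nonneg fun j _ => kernelReal_nonneg _)
    (mul_nonneg (div_nonneg (by linarith) (by linarith))
      (Finset.sum_nonneg fun i _ => hw.field_nonneg _))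

/-- The discrete energy with values in `[0, ∞]`; it is continuous, and infinite exactly when two
points coincide. -/
noncomputable def extDiscEnergy (d : ℝ) (w : ℂ → ℂ) (a : Fin n → ℝ) : ℝ≥0∞ :=
  (∑ i, ∑ j ∈ Finset.univ.erase i, kernel d (a i - a j)) +
    ENNReal.ofReal (2 * ((n : ℝ) - 1) / n * ∑ i, field w (a i))

lemma IsWeight.continuous_extDiscEnergy (hd : 0 < d) (hw : IsWeight d w) :
    Continuous (extDiscEnergy (n := n) d w) := by
  have h1 := continuous_kernel hd
  have h2 := hw.continuous_field
  unfold extDiscEnergy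
  refine Continuous.add ?_ ?_
  · exact continuous_finsetSum _ fun i _ => continuous_finsetSum _ fun j _ =>
      h1.comp (by fun_prop)
  · exact ENNReal.continuous_ofReal.comp (by fun_prop)

lemma extDiscEnergy_of_injective (hw : IsWeight d w) (hn : 1 ≤ n) {a : Fin n → ℝ}
    (ha : Function.Injective a) : extDiscEnergy d w a = ENNReal.ofReal (discEnergy d w a) := by
  have hn' : (1 : ℝ) ≤ n := by exact_mod_cast hn
  rw [extDiscEnergy, discEnergy, ENNReal.ofReal_add
    (Finset.sum_nonneg fun i _ => Finset.sum_nonneg fun j _ => kernelReal_nonneg _)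
    (mul_nonneg (div_nonneg (by linarith) (by linarith))
      (Finset.sum_nonneg fun i _ => hw.field_nonneg _)),
    ENNReal.ofReal_sum_of_nonneg fun i _ => Finset.sum_nonneg fun j _ => kernelReal_nonneg _]
  congr 1
  refine Finset.sum_congr rfl fun i _ => ?_
  rw [ENNReal.ofReal_sum_of_nonneg fun j _ => kernelReal_nonneg _]
  refine Finset.sum_congr rfl fun j hj => kernel_of_ne ?_
  exact sub_ne_zero.2 (ha.ne (Finset.ne_of_mem_erase hj).symm)

lemma injective_of_extDiscEnergy_ne_top {a : Fin n → ℝ} (h : extDiscEnergy d w a ≠ ⊤) :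
    Function.Injective a := by
  intro i j hij
  by_contra hne
  have h1 := (ENNReal.add_ne_top.1 h).1
  have h2 := (ENNReal.sum_ne_top.1 h1) i (Finset.mem_univ i)
  have h3 := (ENNReal.sum_ne_top.1 h2) j (Finset.mem_erase.2 ⟨fun e => hne e.symm, Finset.mem_univ j⟩)
  rw [hij, sub_self] at h3
  exact h3 kernel_zero

/-- The discrete energy attains its minimum. -/
lemma IsWeight.exists_isDiscMinimizer (hd : 0 < d) (hw : IsWeight d w) (hn : 2 ≤ n) :
    ∃ a : Fin n → ℝ, IsDiscMinimizer d w a := by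
  have hn' : (2 : ℝ) ≤ n := by exact_mod_cast hn
  have hcoef : 0 < 2 * ((n : ℝ) - 1) / n := div_pos (by linarith) (by linarith)
  let b₀ : Fin n → ℝ := fun i => ((i : ℕ) : ℝ)
  have hb₀ : StrictMono b₀ := fun i j hij => Nat.cast_lt.2 hij
  obtain ⟨R₀, hR₀⟩ := hw.exists_le_field hd (discEnergy d w b₀ / (2 * ((n : ℝ) - 1) / n))
  let R := max R₀ n
  let S : Set (Fin n → ℝ) := {a | Monotone a} ∩ Set.pi Set.univ fun _ => Set.Icc (-R) R
  have hS : IsCompact S := (isCompact_univ_pi fun _ => isCompact_Icc).inter_left isClosed_monotone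
  have hb₀S : b₀ ∈ S := by
    refine ⟨hb₀.monotone, fun i _ => ?_⟩
    have h1 : b₀ i ≤ n := Nat.cast_le.2 i.2.le
    have h2 : 0 ≤ b₀ i := Nat.cast_nonneg _
    have h3 : (n : ℝ) ≤ R := le_max_right _ _
    exact ⟨by linarith, by linarith⟩
  obtain ⟨a, haS, ha⟩ := hS.exists_isMinOn ⟨b₀, hb₀S⟩
    (hw.continuous_extDiscEnergy hd).continuousOn
  have h0 : extDiscEnergy d w a ≤ extDiscEnergy d w b₀ := ha hb₀S
  have hinj : Function.Injective a := by
    refine injective_of_extDiscEnergy_ne_top (d := d) (w := w) (ne_top_of_le_ne_top ?_ h0)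
    rw [extDiscEnergy_of_injective hw (by omega) hb₀.injective]
    exact ENNReal.ofReal_ne_top
  have hnonneg : ∀ b : Fin n → ℝ, 0 ≤ discEnergy d w b := fun b => by
    rw [discEnergy_eq]
    exact add_nonneg (Finset.sum_nonneg fun i _ => Finset.sum_nonneg fun j _ => kernelReal_nonneg _)
      (mul_nonneg hcoef.le (Finset.sum_nonneg fun i _ => hw.field_nonneg _))
  refine ⟨a, haS.1.strictMono_of_injective hinj, fun b hb => ?_⟩
  rw [extDiscEnergy_of_injective hw (by omega) hinj,
    extDiscEnergy_of_injective hw (by omega) hb₀.injective,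
    ENNReal.ofReal_le_ofReal_iff (hnonneg _)] at h0
  by_cases hbS : b ∈ S
  · have h1 : extDiscEnergy d w a ≤ extDiscEnergy d w b := ha hbS
    rwa [extDiscEnergy_of_injective hw (by omega) hinj,
      extDiscEnergy_of_injective hw (by omega) hb.injective,
      ENNReal.ofReal_le_ofReal_iff (hnonneg _)] at h1
  · have h1 : ∃ i, R < |b i| := by
      by_contra hcon
      push Not at hcon
      exact hbS ⟨hb.monotone, fun i _ => abs_le.1 (hcon i)⟩
    obtain ⟨i, hi⟩ := h1
    have h2 := hR₀ (b i) ((le_max_left _ _).trans_lt hi)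
    rw [div_le_iff₀ hcoef] at h2
    refine h0.trans (h2.trans ?_)
    rw [discEnergy_eq, mul_comm]
    refine le_add_of_nonneg_of_le
      (Finset.sum_nonneg fun i _ => Finset.sum_nonneg fun j _ => kernelReal_nonneg _) ?_
    exact mul_le_mul_of_nonneg_left (Finset.single_le_sum (f := fun i => field w (b i))
      (fun j _ => hw.field_nonneg _) (Finset.mem_univ i)) hcoef.le

end

section

variable {d : ℝ} {w : ℂ → ℂ}

/-! ### Smearing a configuration of points -/

lemma setLIntegral_Ioo_ofReal {g : ℝ → ℝ} (hg : IntervalIntegrable g volume 0 1)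
    (h0 : ∀ u ∈ Set.Ioo (0 : ℝ) 1, 0 ≤ g u) :
    ∫⁻ u in Set.Ioo (0 : ℝ) 1, ENNReal.ofReal (g u) = ENNReal.ofReal (∫ u in (0 : ℝ)..1, g u) := by
  rw [intervalIntegral.integral_of_le zero_le_one, integral_Ioc_eq_integral_Ioo,
    ofReal_integral_eq_lintegral_ofReal]
  · exact (intervalIntegrable_iff_integrableOn_Ioo_of_le zero_le_one).1 hg
  · exact (ae_restrict_iff' measurableSet_Ioo).2 (.of_forall h0)

lemma lintegral_sub_mul_log {α β : ℝ} (hα : 0 ≤ α) (hβ : 0 ≤ β) :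
    ∫⁻ u in Set.Ioo (0 : ℝ) 1, ENNReal.ofReal (α - β * Real.log u) = ENNReal.ofReal (α + β) := by
  have hi : IntervalIntegrable Real.log volume 0 1 := intervalIntegral.intervalIntegrable_log'
  rw [setLIntegral_Ioo_ofReal (intervalIntegrable_const.sub (hi.const_mul β))]
  · rw [intervalIntegral.integral_sub intervalIntegrable_const (hi.const_mul β),
      intervalIntegral.integral_const_mul, integral_log]
    simp
  · intro u hu
    have := mul_nonpos_of_nonneg_of_nonpos hβ (Real.log_nonpos hu.1.le hu.2.le)
    linarith

lemma lintegral_sub_mul_log_one_sub {α β : ℝ} (hα : 0 ≤ α) (hβ : 0 ≤ β) :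
    ∫⁻ u in Set.Ioo (0 : ℝ) 1, ENNReal.ofReal (α - β * Real.log (1 - u)) =
      ENNReal.ofReal (α + β) := by
  have hi : IntervalIntegrable Real.log volume 0 1 := intervalIntegral.intervalIntegrable_log'
  have hi2 : IntervalIntegrable (fun u => Real.log (1 - u)) volume 0 1 := by
    have := (hi.comp_sub_left 1).symm
    simpa using this
  rw [setLIntegral_Ioo_ofReal (intervalIntegrable_const.sub (hi2.const_mul β))]
  · rw [intervalIntegral.integral_sub intervalIntegrable_const (hi2.const_mul β),
      intervalIntegral.integral_const_mul, intervalIntegral.integral_comp_sub_left Real.log,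
      integral_log]
    simp
  · intro u hu
    have := mul_nonpos_of_nonneg_of_nonpos hβ
      (Real.log_nonpos (x := 1 - u) (by linarith [hu.2]) (by linarith [hu.1]))
    linarith

/-- The integral is `1` plus the binary entropy of `v`. -/
lemma lintegral_sub_log_abs_sub_le {α v : ℝ} (hα : 0 ≤ α) (hv : v ∈ Set.Ioo (0 : ℝ) 1) :
    ∫⁻ u in Set.Ioo (0 : ℝ) 1, ENNReal.ofReal (α - Real.log |u - v|) ≤
      ENNReal.ofReal (α + (1 + Real.log 2)) := by
  have hi : IntervalIntegrable (fun u => Real.log (u - v)) volume 0 1 := by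
    have h := (intervalIntegral.intervalIntegrable_log' (a := 0 - v) (b := 1 - v)).comp_sub_right v
    simpa using h
  simp_rw [Real.log_abs]
  rw [setLIntegral_Ioo_ofReal (intervalIntegrable_const.sub hi)]
  · rw [intervalIntegral.integral_sub intervalIntegrable_const hi,
      intervalIntegral.integral_comp_sub_right Real.log, integral_log]
    refine ENNReal.ofReal_le_ofReal ?_
    have h := Real.binEntropy_le_log_two (p := v)
    rw [Real.binEntropy_eq_negMulLog_add_negMulLog_one_sub, Real.negMulLog, Real.negMulLog] at h
    simp only [zero_sub, Real.log_neg_eq_log, intervalIntegral.integral_const, sub_zero, one_smul]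
    linarith
  · intro u hu
    have : Real.log (u - v) ≤ 0 := by
      rw [← Real.log_abs]
      exact Real.log_nonpos (abs_nonneg _)
        (abs_le.2 ⟨by linarith [hu.1, hv.2], by linarith [hu.2, hv.1]⟩)
    linarith

/-- The uniform probability measure on the interval from `x` to `x + l`. -/
noncomputable def uniformOn (x l : ℝ) : Measure ℝ :=
  (volume.restrict (Set.Ioo (0 : ℝ) 1)).map fun u => x + u * l

lemma lintegral_uniformOn (x l : ℝ) {f : ℝ → ℝ≥0∞} (hf : Measurable f) :
    ∫⁻ y, f y ∂uniformOn x l = ∫⁻ u in Set.Ioo (0 : ℝ) 1, f (x + u * l) :=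
  lintegral_map hf (by fun_prop)

instance (x l : ℝ) : IsProbabilityMeasure (uniformOn x l) := ⟨by
  rw [uniformOn, Measure.map_apply (by fun_prop) MeasurableSet.univ]; simp⟩

/-- The mutual energy of two uniform measures. -/
noncomputable def mutualEnergy (d x l y k : ℝ) : ℝ≥0∞ :=
  ∫⁻ t, potential d (uniformOn x l) t ∂uniformOn y k

lemma mutualEnergy_eq (hd : 0 < d) (x l y k : ℝ) : mutualEnergy d x l y k =
    ∫⁻ v in Set.Ioo (0 : ℝ) 1, ∫⁻ u in Set.Ioo (0 : ℝ) 1,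
      kernel d (x + u * l - (y + v * k)) := by
  rw [mutualEnergy, lintegral_uniformOn _ _ (measurable_potential hd _)]
  refine lintegral_congr fun v => ?_
  exact lintegral_uniformOn x l ((measurable_kernel hd).comp (measurable_id.sub_const _))

lemma setLIntegral_Ioo_le {f : ℝ → ℝ≥0∞} {C : ℝ≥0∞}
    (h : ∀ u ∈ Set.Ioo (0 : ℝ) 1, f u ≤ C) : ∫⁻ u in Set.Ioo (0 : ℝ) 1, f u ≤ C :=
  (setLIntegral_mono' measurableSet_Ioo h).trans (by simp)

lemma mutualEnergy_self_le (hd : 0 < d) {l : ℝ} (hl : 0 < l) (x : ℝ) :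
    mutualEnergy d x l x l ≤ ENNReal.ofReal (kernelReal d l + (1 + Real.log 2)) := by
  rw [mutualEnergy_eq hd]
  refine setLIntegral_Ioo_le fun v hv => ?_
  refine le_trans (lintegral_mono_ae ?_) (lintegral_sub_log_abs_sub_le (kernelReal_nonneg l) hv)
  have hne : ∀ᵐ u : ℝ, u ≠ v := by
    rw [ae_iff]; simp
  filter_upwards [ae_restrict_of_ae hne, ae_restrict_mem measurableSet_Ioo] with u huv hu
  have h0 : 0 < |u - v| := abs_pos.2 (sub_ne_zero.2 huv)
  have h1 : |u - v| ≤ 1 := abs_le.2 ⟨by linarith [hu.1, hv.2], by linarith [hu.2, hv.1]⟩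
  have h2 : kernel d (x + u * l - (x + v * l)) ≤ kernel d (|u - v| * l) := by
    refine kernel_anti hd (le_of_eq ?_)
    rw [show x + u * l - (x + v * l) = (u - v) * l by ring, abs_mul, abs_mul, abs_abs]
  refine h2.trans ?_
  rw [kernel_of_ne (by positivity)]
  exact ENNReal.ofReal_le_ofReal (kernelReal_mul_le hd h0 h1 hl)

/-- Adjacent intervals of lengths `l` and `k`. The concavity of the logarithm, with weights
proportional to the lengths, makes the cost of smearing exactly `1`. -/
lemma mutualEnergy_adjacent_le (hd : 0 < d) {l k : ℝ} (hl : 0 < l) (hk : 0 < k) (x : ℝ) :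
    mutualEnergy d x l (x + l) k ≤ ENNReal.ofReal (kernelReal d (l + k) + 1) := by
  set p := l / (l + k) with hp
  set q := k / (l + k) with hq
  have hp0 : 0 ≤ p := by positivity
  have hq0 : 0 ≤ q := by positivity
  have hpq : p + q = 1 := by rw [hp, hq]; field_simp
  have key : ∀ v ∈ Set.Ioo (0 : ℝ) 1, ∀ u ∈ Set.Ioo (0 : ℝ) 1,
      kernel d (x + u * l - (x + l + v * k)) ≤
        ENNReal.ofReal (kernelReal d (l + k) - q * Real.log v - p * Real.log (1 - u)) := by
    intro v hv u hu
    have hu' : 0 < 1 - u := by linarith [hu.2]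
    have hlog := strictConcaveOn_log_Ioi.concaveOn.2 hu' hv.1 hp0 hq0 hpq
    simp only [smul_eq_mul] at hlog
    set θ := p * (1 - u) + q * v with hθ
    have hθ0 : 0 < θ := (convex_Ioi (0 : ℝ)) hu' hv.1 hp0 hq0 hpq
    have hθ1 : θ ≤ 1 := by
      have h1 := mul_le_mul_of_nonneg_left (by linarith [hu.1] : 1 - u ≤ 1) hp0
      have h2 := mul_le_mul_of_nonneg_left hv.2.le hq0
      linarith
    have e : x + u * l - (x + l + v * k) = -(θ * (l + k)) := by
      rw [hθ, hp, hq]; field_simp; ring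
    rw [e, kernel_neg, kernel_of_ne (by positivity)]
    refine ENNReal.ofReal_le_ofReal ?_
    have := kernelReal_mul_le hd hθ0 hθ1 (add_pos hl hk)
    linarith
  rw [mutualEnergy_eq hd]
  have hK := kernelReal_nonneg (d := d) (l + k)
  calc _ ≤ ∫⁻ v in Set.Ioo (0 : ℝ) 1,
        ENNReal.ofReal (kernelReal d (l + k) + p - q * Real.log v) := by
        refine setLIntegral_mono' measurableSet_Ioo fun v hv => ?_
        refine (setLIntegral_mono' measurableSet_Ioo (key v hv)).trans (le_of_eq ?_)
        have := mul_nonpos_of_nonneg_of_nonpos hq0 (Real.log_nonpos hv.1.le hv.2.le)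
        rw [lintegral_sub_mul_log_one_sub (by linarith) hp0]
        congr 1
        ring
    _ = _ := by
        rw [lintegral_sub_mul_log (by linarith) hq0, add_assoc, hpq]

lemma mutualEnergy_far_le (hd : 0 < d) {x l y k : ℝ} (hl : 0 < l) (hk : 0 < k) (hxy : x + l < y) :
    mutualEnergy d x l y k ≤ ENNReal.ofReal (kernelReal d (y - (x + l))) := by
  rw [mutualEnergy_eq hd]
  refine setLIntegral_Ioo_le fun v hv => setLIntegral_Ioo_le fun u hu => ?_
  rw [← kernel_of_ne (by linarith)]
  refine kernel_anti hd ?_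
  have h1 : u * l ≤ l := by nlinarith [hu.2]
  have h2 : 0 ≤ v * k := mul_nonneg hv.1.le hk.le
  rw [abs_of_pos (by linarith), abs_of_neg (by linarith)]
  linarith

lemma sum_comp_le_of_injOn {α β : Type*} [Fintype β] [DecidableEq β] {s : Finset α} {g : α → β}
    {f : β → ℝ} (hg : Set.InjOn g s) (hf : ∀ y, 0 ≤ f y) : ∑ x ∈ s, f (g x) ≤ ∑ y, f y := by
  rw [← Finset.sum_image hg]
  exact Finset.sum_le_univ_sum_of_nonneg hf

variable {m : ℕ}

/-- The pair of outer end points of two intervals between consecutive points. -/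
def outerEnds (z : Fin m × Fin m) : Fin (m + 1) × Fin (m + 1) :=
  if z.1 ≤ z.2 then (z.1.castSucc, z.2.succ) else (z.1.succ, z.2.castSucc)

/-- The pair of inner end points of two intervals between consecutive points. -/
def innerEnds (z : Fin m × Fin m) : Fin (m + 1) × Fin (m + 1) :=
  if z.1 ≤ z.2 then (z.1.succ, z.2.castSucc) else (z.1.castSucc, z.2.succ)

lemma injective_outerEnds : Function.Injective (outerEnds (m := m)) := by
  rintro ⟨i, j⟩ ⟨i', j'⟩ h
  simp only [outerEnds] at h
  split_ifs at h with h1 h2 h2 <;>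
    simp only [Prod.mk.injEq, Fin.ext_iff, Fin.le_def, Fin.val_castSucc, Fin.val_succ] at * <;> omega

/-- Pairs of distinct and not adjacent intervals. -/
def farPairs (m : ℕ) : Finset (Fin m × Fin m) :=
  Finset.univ.filter fun z => (z.1 : ℕ) + 1 < z.2 ∨ (z.2 : ℕ) + 1 < z.1

lemma injOn_innerEnds : Set.InjOn (innerEnds (m := m)) (farPairs m) := by
  rintro ⟨i, j⟩ hz ⟨i', j'⟩ hz' h
  simp only [farPairs, Finset.coe_filter, Finset.mem_univ, true_and, Set.mem_ofPred_eq] at hz hz'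
  simp only [innerEnds] at h
  split_ifs at h with h1 h2 h2 <;>
    simp only [Prod.mk.injEq, Fin.ext_iff, Fin.le_def, Fin.val_castSucc, Fin.val_succ] at * <;> omega

/-- The cost of smearing two points, in units of energy: it occurs for equal and for adjacent
intervals only. -/
noncomputable def smearCost (z : Fin m × Fin m) : ℝ :=
  (if z.1 = z.2 then 1 + Real.log 2 else 0) + (if (z.1 : ℕ) + 1 = z.2 then 1 else 0) +
    (if (z.2 : ℕ) + 1 = z.1 then 1 else 0)

lemma sum_smearCost_le : ∑ z : Fin m × Fin m, smearCost z ≤ m * (3 + Real.log 2) := by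
  have h1 : ∀ i : Fin m, ∑ j : Fin m, (if (i : ℕ) + 1 = j then (1 : ℝ) else 0) ≤ 1 := by
    intro i
    rw [Finset.sum_boole]
    norm_cast
    refine Finset.card_le_one.2 fun a ha b hb => ?_
    simp only [Finset.mem_filter] at ha hb
    exact Fin.ext (by omega)
  have h2 : ∀ i : Fin m, ∑ j : Fin m, (if (j : ℕ) + 1 = i then (1 : ℝ) else 0) ≤ 1 := by
    intro i
    rw [Finset.sum_boole]
    norm_cast
    refine Finset.card_le_one.2 fun a ha b hb => ?_
    simp only [Finset.mem_filter] at ha hb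
    exact Fin.ext (by omega)
  have h3 : ∀ i : Fin m, ∑ j : Fin m, smearCost (i, j) ≤ 3 + Real.log 2 := by
    intro i
    simp only [smearCost, Finset.sum_add_distrib, Finset.sum_ite_eq, Finset.mem_univ, if_true]
    linarith [h1 i, h2 i]
  rw [Fintype.sum_prod_type]
  calc _ ≤ ∑ _i : Fin m, (3 + Real.log 2) := Finset.sum_le_sum fun i _ => h3 i
    _ = _ := by simp [mul_add]

end

section

variable {d : ℝ} {w : ℂ → ℂ} {m : ℕ}

/-- The uniform measure on the `i`-th interval between consecutive points of `a`. -/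
noncomputable def gapMeasure (a : Fin (m + 1) → ℝ) (i : Fin m) : Measure ℝ :=
  uniformOn (a i.castSucc) (a i.succ - a i.castSucc)

instance (a : Fin (m + 1) → ℝ) (i : Fin m) : IsProbabilityMeasure (gapMeasure a i) := by
  unfold gapMeasure; infer_instance

/-- The energy bound for a pair of intervals. -/
noncomputable def pairBound (d : ℝ) (a : Fin (m + 1) → ℝ) (z : Fin m × Fin m) : ℝ :=
  kernelReal d (a (outerEnds z).1 - a (outerEnds z).2) +
    (if z ∈ farPairs m then kernelReal d (a (innerEnds z).1 - a (innerEnds z).2) else 0) +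
      smearCost z

lemma smearCost_nonneg (z : Fin m × Fin m) : 0 ≤ smearCost z := by
  have := Real.log_pos one_lt_two
  unfold smearCost
  positivity

lemma pairBound_nonneg (a : Fin (m + 1) → ℝ) (z : Fin m × Fin m) : 0 ≤ pairBound d a z := by
  have h1 := kernelReal_nonneg (d := d) (a (outerEnds z).1 - a (outerEnds z).2)
  have h2 := kernelReal_nonneg (d := d) (a (innerEnds z).1 - a (innerEnds z).2)
  have h3 := smearCost_nonneg z
  unfold pairBound
  split_ifs <;> linarith

lemma lintegral_potential_gapMeasure_le (hd : 0 < d) {a : Fin (m + 1) → ℝ} (ha : StrictMono a)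
    (i j : Fin m) : ∫⁻ t, potential d (gapMeasure a i) t ∂gapMeasure a j ≤
      ENNReal.ofReal (pairBound d a (i, j)) := by
  -- the bound is symmetric, so it suffices to treat intervals in their natural order
  have hle : ∀ i j : Fin m, i ≤ j → ∫⁻ t, potential d (gapMeasure a i) t ∂gapMeasure a j ≤
      ENNReal.ofReal (kernelReal d (a j.succ - a i.castSucc) +
        (if (i : ℕ) + 1 < j then kernelReal d (a j.castSucc - a i.succ) else 0) +
        ((if i = j then 1 + Real.log 2 else 0) + (if (i : ℕ) + 1 = j then 1 else 0))) := by
    intro i j hij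
    have hlen : ∀ i : Fin m, 0 < a i.succ - a i.castSucc := fun i =>
      sub_pos.2 (ha i.castSucc_lt_succ)
    rcases hij.eq_or_lt with rfl | hlt
    · have := mutualEnergy_self_le hd (hlen i) (a i.castSucc)
      refine this.trans (ENNReal.ofReal_le_ofReal ?_)
      simp
    · rcases Nat.eq_or_lt_of_le (Nat.succ_le_of_lt hlt) with hadj | hfar
      · have e : i.succ = j.castSucc := Fin.ext hadj
        have := mutualEnergy_adjacent_le hd (hlen i) (hlen j) (a i.castSucc)
        rw [add_sub_cancel, e] at this
        refine (le_of_eq ?_).trans (this.trans (ENNReal.ofReal_le_ofReal ?_))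
        · rw [gapMeasure, gapMeasure, mutualEnergy, e]
        · have h1 : (i : ℕ) + 1 = j := hadj
          rw [if_neg (by omega), if_neg hlt.ne, if_pos h1, show a j.castSucc - a i.castSucc +
            (a j.succ - a j.castSucc) = a j.succ - a i.castSucc by ring]
          linarith
      · have hlt' : i.succ < j.castSucc := hfar
        have := mutualEnergy_far_le hd (x := a i.castSucc) (hlen i) (hlen j)
          (y := a j.castSucc) (by rw [add_sub_cancel]; exact ha hlt')
        refine this.trans (ENNReal.ofReal_le_ofReal ?_)
        have h1 : (i : ℕ) + 1 < j := hfar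
        rw [add_sub_cancel, if_pos h1, if_neg hlt.ne, if_neg h1.ne]
        linarith [kernelReal_nonneg (d := d) (a j.succ - a i.castSucc)]
  rcases le_or_gt i j with hij | hij
  · refine (hle i j hij).trans (ENNReal.ofReal_le_ofReal (le_of_eq ?_))
    have h1 : (i : ℕ) ≤ j := hij
    have h2 : ((i, j) ∈ farPairs m) ↔ (i : ℕ) + 1 < j := by
      simp only [farPairs, Finset.mem_filter, Finset.mem_univ, true_and]; omega
    have h3 : ¬ ((j : ℕ) + 1 = i) := by omega
    simp only [pairBound, outerEnds, innerEnds, smearCost, if_pos hij, h2, if_neg h3, add_zero]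
    rw [kernelReal_sub_comm (a j.succ), kernelReal_sub_comm (a j.castSucc)]
  · rw [lintegral_potential_comm hd]
    refine (hle j i hij.le).trans (ENNReal.ofReal_le_ofReal (le_of_eq ?_))
    have h1 : (j : ℕ) < i := hij
    have h2 : ((i, j) ∈ farPairs m) ↔ (j : ℕ) + 1 < i := by
      simp only [farPairs, Finset.mem_filter, Finset.mem_univ, true_and]; omega
    have h3 : ¬ ((i : ℕ) + 1 = j) := by omega
    simp only [pairBound, outerEnds, innerEnds, smearCost, if_neg (not_le.2 hij), h2, if_neg h3,
      add_zero, if_neg hij.ne, if_neg hij.ne']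

lemma sum_pairBound_le (a : Fin (m + 1) → ℝ) : ∑ z, pairBound d a z ≤
    2 * (∑ p, ∑ q, kernelReal d (a p - a q)) + m * (3 + Real.log 2) := by
  have hf : ∀ y : Fin (m + 1) × Fin (m + 1), 0 ≤ kernelReal d (a y.1 - a y.2) := fun y =>
    kernelReal_nonneg _
  have h1 := sum_comp_le_of_injOn (s := Finset.univ) (g := outerEnds (m := m))
    injective_outerEnds.injOn hf
  have h2 := sum_comp_le_of_injOn (g := innerEnds (m := m)) injOn_innerEnds hf
  have h3 := sum_smearCost_le (m := m)
  rw [Fintype.sum_prod_type (fun y : Fin (m + 1) × Fin (m + 1) =>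
    kernelReal d (a y.1 - a y.2))] at h1 h2
  have h4 : ∑ z : Fin m × Fin m, (if z ∈ farPairs m then
      kernelReal d (a (innerEnds z).1 - a (innerEnds z).2) else 0) =
      ∑ z ∈ farPairs m, kernelReal d (a (innerEnds z).1 - a (innerEnds z).2) := by
    rw [← Finset.sum_filter, Finset.filter_univ_mem]
  simp only [pairBound, Finset.sum_add_distrib, h4]
  linarith

/-- By convexity the field energy of a uniform measure is at most the mean of the end point
values. -/
lemma lintegral_field_gapMeasure_le (hw : IsWeight d w) (a : Fin (m + 1) → ℝ) (i : Fin m) :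
    ∫⁻ x, ENNReal.ofReal (field w x) ∂gapMeasure a i ≤
      ENNReal.ofReal ((field w (a i.castSucc) + field w (a i.succ)) / 2) := by
  have hc := hw.continuous_field
  rw [gapMeasure, lintegral_uniformOn _ _ (by fun_prop)]
  set p := field w (a i.castSucc) with hp
  set q := field w (a i.succ) with hq
  have hp0 : 0 ≤ p := hw.field_nonneg _
  have hq0 : 0 ≤ q := hw.field_nonneg _
  have h1 : ∀ u ∈ Set.Ioo (0 : ℝ) 1,
      ENNReal.ofReal (field w (a i.castSucc + u * (a i.succ - a i.castSucc))) ≤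
        ENNReal.ofReal (p + u * (q - p)) := by
    intro u hu
    refine ENNReal.ofReal_le_ofReal ?_
    have := hw.convexOn_field.2 (Set.mem_univ (a i.castSucc)) (Set.mem_univ (a i.succ))
      (sub_nonneg.2 hu.2.le) hu.1.le (by ring)
    simp only [smul_eq_mul] at this
    rw [show a i.castSucc + u * (a i.succ - a i.castSucc) =
      (1 - u) * a i.castSucc + u * a i.succ by ring]
    linarith
  refine (setLIntegral_mono' measurableSet_Ioo h1).trans (le_of_eq ?_)
  rw [setLIntegral_Ioo_ofReal (Continuous.intervalIntegrable (by fun_prop) _ _)]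
  · rw [intervalIntegral.integral_add intervalIntegrable_const
      (Continuous.intervalIntegrable (by fun_prop) _ _), intervalIntegral.integral_mul_const,
      integral_id]
    simp only [intervalIntegral.integral_const]
    congr 1
    simp
    ring
  · intro u hu
    nlinarith [hu.1, hu.2, mul_nonneg hu.1.le hq0, mul_nonneg (sub_nonneg.2 hu.2.le) hp0]

lemma fieldEnergy_sum_gapMeasure_le (hw : IsWeight d w) (a : Fin (m + 1) → ℝ) :
    ∑ i, ∫⁻ x, ENNReal.ofReal (field w x) ∂gapMeasure a i ≤
      ENNReal.ofReal (∑ p, field w (a p)) := by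
  refine (Finset.sum_le_sum fun i _ => lintegral_field_gapMeasure_le hw a i).trans ?_
  rw [← ENNReal.ofReal_sum_of_nonneg fun i _ =>
    div_nonneg (add_nonneg (hw.field_nonneg _) (hw.field_nonneg _)) zero_le_two]
  refine ENNReal.ofReal_le_ofReal ?_
  rw [← Finset.sum_div, Finset.sum_add_distrib]
  have h1 := Fin.sum_univ_castSucc fun p => field w (a p)
  have h2 := Fin.sum_univ_succ fun p => field w (a p)
  have h3 := hw.field_nonneg (a (Fin.last m))
  have h4 := hw.field_nonneg (a 0)
  linarith

/-- Any configuration of `n` points can be smeared to a measure of mass `n`, spread uniformly over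
the `n - 1` intervals, whose continuous energy is controlled by the discrete one. -/
lemma exists_contEnergy_le (hd : 0 < d) (hw : IsWeight d w) {n : ℕ} (hn : 2 ≤ n) {a : Fin n → ℝ}
    (ha : StrictMono a) : ∃ ν : Measure ℝ, ν Set.univ = n ∧ contEnergy d w ν ≤
      ENNReal.ofReal (((n : ℝ) / (n - 1)) ^ 2 *
        (2 * discF d w a + (n - 1) * (3 + Real.log 2))) := by
  obtain ⟨m, rfl⟩ : ∃ m, n = m + 1 := ⟨n - 1, by omega⟩
  have hm : (0 : ℝ) < m := by exact_mod_cast (by omega : 0 < m)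
  set c : ℝ := ((m : ℝ) + 1) / m with hc
  have hc0 : 0 < c := by positivity
  have hlog := Real.log_pos one_lt_two
  refine ⟨ENNReal.ofReal c • ∑ i, gapMeasure a i, ?_, ?_⟩
  · simp only [Measure.smul_apply, Measure.finsetSum_apply, measure_univ, Finset.sum_const,
      Finset.card_univ, Fintype.card_fin, smul_eq_mul, nsmul_eq_mul, mul_one]
    rw [← ENNReal.ofReal_natCast, ← ENNReal.ofReal_natCast, ← ENNReal.ofReal_mul hc0.le]
    congr 1
    rw [hc]; push_cast; field_simp
  have h1 : interaction d (∑ i, gapMeasure a i) ≤ ENNReal.ofReal (∑ z, pairBound d a z) := by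
    rw [ENNReal.ofReal_sum_of_nonneg fun z _ => pairBound_nonneg a z, Fintype.sum_prod_type_right,
      interaction_eq, lintegral_finsetSum_measure]
    refine Finset.sum_le_sum fun j _ => ?_
    have e : potential d (∑ i, gapMeasure a i) = fun t => ∑ i, potential d (gapMeasure a i) t := by
      ext t
      exact lintegral_finsetSum_measure _ _ _
    rw [e, lintegral_finsetSum _ fun i _ => measurable_potential hd _]
    exact Finset.sum_le_sum fun i _ => lintegral_potential_gapMeasure_le hd ha i j
  have h2 : fieldEnergy w (∑ i, gapMeasure a i) ≤ ENNReal.ofReal (∑ p, field w (a p)) := by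
    rw [fieldEnergy, lintegral_finsetSum_measure]
    exact fieldEnergy_sum_gapMeasure_le hw a
  set A := ∑ p, ∑ q, kernelReal d (a p - a q) with hA
  set B := ∑ p, field w (a p) with hB
  have hA0 : 0 ≤ A := Finset.sum_nonneg fun i _ => Finset.sum_nonneg fun j _ => kernelReal_nonneg _
  have hB0 : 0 ≤ B := Finset.sum_nonneg fun i _ => hw.field_nonneg _
  have hF : discF d w a = A + (m : ℝ) / (m + 1) * B := by
    rw [discF_eq]; push_cast; rw [add_sub_cancel_right]
  have h3 : interaction d (∑ i, gapMeasure a i) ≤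
      ENNReal.ofReal (2 * A + m * (3 + Real.log 2)) :=
    h1.trans (ENNReal.ofReal_le_ofReal (sum_pairBound_le a))
  rw [contEnergy, interaction_smul ENNReal.ofReal_ne_top, fieldEnergy, lintegral_smul_measure,
    smul_eq_mul]
  calc _ ≤ ENNReal.ofReal c ^ 2 * ENNReal.ofReal (2 * A + m * (3 + Real.log 2)) +
        2 * (ENNReal.ofReal c * ENNReal.ofReal B) := by gcongr; exact h2
    _ = ENNReal.ofReal (c ^ 2 * (2 * A + m * (3 + Real.log 2)) + 2 * (c * B)) := by
        have hX : 0 ≤ 2 * A + m * (3 + Real.log 2) := by positivity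
        rw [ENNReal.ofReal_add (mul_nonneg (by positivity) hX) (by positivity),
          ENNReal.ofReal_mul (sq_nonneg c), ENNReal.ofReal_mul zero_le_two,
          ENNReal.ofReal_mul hc0.le, ENNReal.ofReal_pow hc0.le, ENNReal.ofReal_ofNat]
    _ ≤ _ := by
        refine ENNReal.ofReal_le_ofReal (le_of_eq ?_)
        rw [hF, hc]; push_cast; rw [add_sub_cancel_right]; field_simp; ring

end

section

/-! ### Interpolation of bounded analytic functions on the disc -/

lemma norm_circleAverage_le {F : ℂ → ℂ} {r C : ℝ} (hr : 0 ≤ r)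
    (h : ∀ z : ℂ, ‖z‖ = r → ‖F z‖ ≤ C) : ‖Real.circleAverage F 0 r‖ ≤ C := by
  have hpi := Real.pi_pos
  have h1 := intervalIntegral.norm_integral_le_of_norm_le_const (a := 0) (b := 2 * Real.pi)
    (f := fun θ => F (circleMap 0 r θ)) (C := C)
    (fun θ _ => h _ (by rw [norm_circleMap_zero, abs_of_nonneg hr]))
  rw [Real.circleAverage_def, norm_smul, norm_inv, Real.norm_of_nonneg (by positivity),
    inv_mul_le_iff₀ (by positivity)]
  rw [sub_zero, abs_of_pos (by positivity)] at h1
  linarith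

/-- Cauchy's formula combined with the partial fraction expansion of `∏ (z - v i)⁻¹`. -/
lemma sum_nodalWeight_mul {ι : Type*} [Fintype ι] [DecidableEq ι] [Nonempty ι] {v : ι → ℂ}
    (hv : Function.Injective v) {r : ℝ} (hr : 0 < r) (hvr : ∀ i, ‖v i‖ < r) {G : ℂ → ℂ}
    (hG : DifferentiableOn ℂ G (Metric.closedBall 0 r)) :
    ∑ i, Lagrange.nodalWeight Finset.univ v i * G (v i) =
      Real.circleAverage (fun z => z / (∏ i, (z - v i)) * G z) 0 r := by
  have hne : ∀ z : ℂ, ‖z‖ = r → ∀ i, z ≠ v i := by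
    rintro z hz i rfl
    exact (hvr i).ne hz
  have hav : ∀ i, Real.circleAverage (fun z => (z - 0) / (z - v i) * G z) 0 r = G (v i) := by
    intro i
    refine DiffContOnCl.circleAverage_smul_div (f := G) (w := v i) ?_ ?_
    · rw [abs_of_pos hr]; exact hG.diffContOnCl_ball le_rfl
    · rw [abs_of_pos hr]; simpa using hvr i
  have hint : ∀ i ∈ Finset.univ, CircleIntegrable (fun z =>
      Lagrange.nodalWeight Finset.univ v i • ((z - 0) / (z - v i) * G z)) 0 r := by
    intro i _
    refine ContinuousOn.circleIntegrable hr.le (continuousOn_const.mul ((ContinuousOn.div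
      (by fun_prop) (by fun_prop) ?_).mul (hG.continuousOn.mono Metric.sphere_subset_closedBall)))
    intro z hz
    exact sub_ne_zero.2 (hne z (by simpa using hz) i)
  have h1 : ∀ i, Lagrange.nodalWeight Finset.univ v i * G (v i) = Real.circleAverage (fun z =>
      Lagrange.nodalWeight Finset.univ v i • ((z - 0) / (z - v i) * G z)) 0 r := by
    intro i
    rw [Real.circleAverage_fun_smul, hav, smul_eq_mul]
  simp_rw [h1]
  rw [← Real.circleAverage_fun_sum hint]
  refine Real.circleAverage_congr_sphere fun z hz => ?_
  rw [abs_of_pos hr] at hz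
  have hz' := hne z (by simpa using hz)
  have h2 := Lagrange.eval_interpolate_not_at_node (s := Finset.univ) (v := v) (x := z)
    (1 : ι → ℂ) (fun i _ => hz' i)
  rw [Lagrange.interpolate_one hv.injOn Finset.univ_nonempty, Polynomial.eval_one,
    Lagrange.eval_nodal] at h2
  simp only [Pi.one_apply, mul_one] at h2
  have h3 : ∏ i, (z - v i) ≠ 0 := Finset.prod_ne_zero_iff.2 fun i _ => sub_ne_zero.2 (hz' i)
  have h4 : ∑ i, Lagrange.nodalWeight Finset.univ v i * (z - v i)⁻¹ = (∏ i, (z - v i))⁻¹ :=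
    eq_inv_of_mul_eq_one_right h2.symm
  simp only [smul_eq_mul, sub_zero]
  rw [div_eq_mul_inv, ← h4, Finset.mul_sum, Finset.sum_mul]
  exact Finset.sum_congr rfl fun i _ => by ring

/-- The modulus of a Blaschke factor on the circle of radius `r`. -/
lemma norm_one_sub_mul_div_le {b r : ℝ} (hb : |b| < r) (hr : r < 1) {z : ℂ} (hz : ‖z‖ = r) :
    ‖(1 - b * z) / (z - b)‖ ≤ (1 - r * |b|) / (r - |b|) := by
  have hb0 := abs_nonneg b
  have hr0 : 0 < r := hb0.trans_lt hb
  have hrb : 0 < 1 - r * |b| := by nlinarith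
  have hzb : z - b ≠ 0 := by
    intro h
    rw [sub_eq_zero.1 h, Complex.norm_real, Real.norm_eq_abs] at hz
    exact hb.ne hz
  rw [norm_div, div_le_div_iff₀ (norm_pos_iff.2 hzb) (by linarith)]
  refine le_of_sq_le_sq ?_ (mul_nonneg hrb.le (norm_nonneg _))
  have hre : b * z.re ≤ r * |b| := by
    have h1 := Complex.abs_re_le_norm z
    rw [hz] at h1
    calc b * z.re ≤ |b * z.re| := le_abs_self _
      _ = |b| * |z.re| := abs_mul _ _
      _ ≤ r * |b| := by rw [mul_comm]; gcongr
  have hn : z.re ^ 2 + z.im ^ 2 = r ^ 2 := by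
    rw [← hz, ← Complex.normSq_eq_norm_sq, Complex.normSq_apply]; ring
  have e1 : ‖(1 : ℂ) - b * z‖ ^ 2 = 1 - 2 * (b * z.re) + b ^ 2 * r ^ 2 := by
    rw [← hn, ← Complex.normSq_eq_norm_sq, Complex.normSq_apply]; simp; ring
  have e2 : ‖z - b‖ ^ 2 = r ^ 2 - 2 * (b * z.re) + b ^ 2 := by
    rw [← hn, ← Complex.normSq_eq_norm_sq, Complex.normSq_apply]; simp; ring
  rw [mul_pow, mul_pow, e1, e2, ← sq_abs b]
  have h2 : 0 ≤ (r * |b| - b * z.re) * ((1 - r ^ 2) * (1 - |b| ^ 2)) := by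
    refine mul_nonneg (by linarith) (mul_nonneg ?_ ?_) <;> nlinarith
  nlinarith

variable {ι : Type*} [Fintype ι] [DecidableEq ι]

/-- The coefficients of the optimal formula for the value at the centre of the disc. -/
noncomputable def discCoeff (β : ι → ℝ) (k : ι) : ℝ :=
  (1 - β k ^ 2) * ∏ j ∈ Finset.univ.erase k, -β j / ((β k - β j) / (1 - β j * β k))

lemma nodalWeight_none (β : ι → ℝ) :
    Lagrange.nodalWeight Finset.univ (fun o : Option ι => o.elim (0 : ℂ) fun k => (β k : ℂ)) none =
      (∏ j, (-β j : ℂ))⁻¹ := by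
  have h : (Finset.univ.erase none : Finset (Option ι)) = Finset.univ.map .some := by
    ext o; cases o <;> simp
  rw [Lagrange.nodalWeight, h, Finset.prod_map, ← Finset.prod_inv_distrib]
  simp

lemma nodalWeight_some (β : ι → ℝ) (k : ι) :
    Lagrange.nodalWeight Finset.univ (fun o : Option ι => o.elim (0 : ℂ) fun k => (β k : ℂ))
      (some k) = (β k : ℂ)⁻¹ * (∏ j ∈ Finset.univ.erase k, ((β k : ℂ) - β j))⁻¹ := by
  have h : (Finset.univ.erase (some k) : Finset (Option ι)) =
      insert none ((Finset.univ.erase k).map .some) := by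
    ext o; cases o <;> simp
  rw [Lagrange.nodalWeight, h, Finset.prod_insert (by simp), Finset.prod_map,
    ← Finset.prod_inv_distrib]
  simp

/-- Optimal recovery at the centre of the disc: the error of the formula with nodes `β` is at most
the modulus `∏ |β j|` of the Blaschke product at the centre. -/
lemma norm_sub_sum_discCoeff_le {β : ι → ℝ} (hβ : Function.Injective β) (hβ0 : ∀ k, β k ≠ 0)
    (hβ1 : ∀ k, |β k| < 1) {g : ℂ → ℂ} (hg : DifferentiableOn ℂ g (Metric.ball 0 1))
    (hg1 : ∀ z ∈ Metric.ball (0 : ℂ) 1, ‖g z‖ ≤ 1) :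
    ‖g 0 - ∑ k, g (β k) * discCoeff β k‖ ≤ ∏ j, |β j| := by
  let v : Option ι → ℂ := fun o => o.elim (0 : ℂ) fun k => (β k : ℂ)
  have hv : Function.Injective v := by
    rintro (_ | i) (_ | j) h
    · rfl
    · exact absurd (Complex.ofReal_eq_zero.1 h.symm) (hβ0 j)
    · exact absurd (Complex.ofReal_eq_zero.1 h) (hβ0 i)
    · rw [hβ (Complex.ofReal_injective h)]
  let G : ℂ → ℂ := fun z => g z * ∏ j, (1 - β j * z)
  set P : ℂ := ∏ j, (-β j : ℂ) with hP
  have hP0 : P ≠ 0 := Finset.prod_ne_zero_iff.2 fun j _ => neg_ne_zero.2 (by exact_mod_cast hβ0 j)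
  have hPn : ‖P‖ = ∏ j, |β j| := by simp [hP, norm_prod]
  -- the quantity to be estimated is a sum of residues
  have hres : g 0 - ∑ k, g (β k) * discCoeff β k =
      P * ∑ o, Lagrange.nodalWeight Finset.univ v o * G (v o) := by
    rw [Fintype.sum_option, nodalWeight_none, mul_add, Finset.mul_sum, sub_eq_add_neg,
      ← Finset.sum_neg_distrib]
    congr 1
    · rw [← mul_assoc, ← hP, mul_inv_cancel₀ hP0]
      simp [v, G]
    · refine Finset.sum_congr rfl fun k _ => ?_
      rw [nodalWeight_some]
      have hk : (β k : ℂ) ≠ 0 := by exact_mod_cast hβ0 k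
      simp only [v, G, Option.elim_some, discCoeff]
      rw [hP, ← Finset.mul_prod_erase _ _ (Finset.mem_univ k),
        ← Finset.mul_prod_erase Finset.univ (fun j => (1 : ℂ) - β j * β k) (Finset.mem_univ k)]
      push_cast
      rw [Finset.prod_div_distrib, Finset.prod_div_distrib]
      field_simp
  have hbound : ∀ r : ℝ, (∀ k, |β k| < r) → 0 < r → r < 1 →
      ‖∑ o, Lagrange.nodalWeight Finset.univ v o * G (v o)‖ ≤
        ∏ j, (1 - r * |β j|) / (r - |β j|) := by
    intro r hr hr0 hr1
    have hsub : Metric.closedBall (0 : ℂ) r ⊆ Metric.ball 0 1 :=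
      Metric.closedBall_subset_ball hr1
    have hG : DifferentiableOn ℂ G (Metric.closedBall 0 r) :=
      (hg.mono hsub).mul (DifferentiableOn.fun_finsetProd fun j _ => by fun_prop)
    rw [sum_nodalWeight_mul hv hr0 ?_ hG]
    · refine norm_circleAverage_le hr0.le fun z hz => ?_
      have hz0 : z ≠ 0 := by rintro rfl; simp at hz; exact hr0.ne hz
      have e : z / (∏ o, (z - v o)) * G z = g z * ∏ j, ((1 - β j * z) / (z - β j)) := by
        rw [Fintype.prod_option, Finset.prod_div_distrib]
        simp only [v, G, Option.elim_some, Option.elim_none, sub_zero]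
        rw [div_mul_eq_div_div, div_self hz0]
        ring
      rw [e, norm_mul, norm_prod]
      have h1 : ‖g z‖ ≤ 1 := hg1 z (by simpa [hz] using hr1)
      have h2 : ∏ j, ‖(1 - β j * z) / (z - β j)‖ ≤ ∏ j, (1 - r * |β j|) / (r - |β j|) :=
        Finset.prod_le_prod (fun _ _ => norm_nonneg _)
          fun j _ => norm_one_sub_mul_div_le (hr j) hr1 hz
      calc _ ≤ 1 * ∏ j, ‖(1 - β j * z) / (z - β j)‖ :=
            mul_le_mul_of_nonneg_right h1 (Finset.prod_nonneg fun _ _ => norm_nonneg _)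
        _ ≤ _ := by rw [one_mul]; exact h2
    · rintro (_ | k)
      · simpa [v] using hr0
      · simpa [v] using hr k
  have hlim : Tendsto (fun r : ℝ => ∏ j, (1 - r * |β j|) / (r - |β j|)) (𝓝[<] 1) (𝓝 1) := by
    have h1 : ∀ j, Tendsto (fun r : ℝ => (1 - r * |β j|) / (r - |β j|)) (𝓝[<] 1) (𝓝 1) := by
      intro j
      have h0 : (1 : ℝ) - |β j| ≠ 0 := (sub_pos.2 (hβ1 j)).ne'
      have hc : ContinuousAt (fun r : ℝ => (1 - r * |β j|) / (r - |β j|)) 1 :=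
        ContinuousAt.div (by fun_prop) (by fun_prop) h0
      have := hc.tendsto
      simp only [one_mul, div_self h0] at this
      exact this.mono_left nhdsWithin_le_nhds
    simpa using tendsto_finsetProd Finset.univ fun j _ => h1 j
  have hle : ‖∑ o, Lagrange.nodalWeight Finset.univ v o * G (v o)‖ ≤ 1 := by
    refine ge_of_tendsto hlim ?_
    have h1 : ∀ᶠ r in 𝓝[<] (1 : ℝ), ∀ k, |β k| < r :=
      eventually_all.2 fun k => nhdsWithin_le_nhds (lt_mem_nhds (hβ1 k))
    filter_upwards [h1, nhdsWithin_le_nhds (lt_mem_nhds one_pos), self_mem_nhdsWithin]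
      with r hr hr0 hr1 using hbound r hr hr0 hr1
  rw [hres, norm_mul, hPn]
  exact mul_le_of_le_one_right (Finset.prod_nonneg fun _ _ => abs_nonneg _) hle

end

section

variable {d : ℝ} {w : ℂ → ℂ} {n : ℕ}

/-! ### The interpolation error -/

/-- The conformal map `(4 d / π) artanh` of the unit disc onto the strip. -/
noncomputable def discToStrip (d : ℝ) (z : ℂ) : ℂ :=
  ((2 * d / Real.pi : ℝ) : ℂ) * Complex.log ((1 + z) / (1 - z))

lemma re_div_pos {z : ℂ} (hz : ‖z‖ < 1) : 0 < ((1 + z) / (1 - z)).re := by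
  have h1 : 1 - z ≠ 0 := by
    intro h
    rw [← sub_eq_zero.1 h, norm_one] at hz
    exact lt_irrefl _ hz
  have h2 : 0 < Complex.normSq (1 - z) := Complex.normSq_pos.2 h1
  have h3 : z.re ^ 2 + z.im ^ 2 < 1 := by
    have : z.re ^ 2 + z.im ^ 2 = ‖z‖ ^ 2 := by
      rw [← Complex.normSq_eq_norm_sq, Complex.normSq_apply]; ring
    rw [this]
    exact pow_lt_one₀ (norm_nonneg _) hz two_ne_zero
  rw [Complex.div_re, ← add_div]
  refine div_pos ?_ h2
  simp
  nlinarith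

lemma differentiableOn_discToStrip :
    DifferentiableOn ℂ (discToStrip d) (Metric.ball 0 1) := by
  intro z hz
  have hz' : ‖z‖ < 1 := by simpa using hz
  have h1 : 1 - z ≠ 0 := by
    intro h
    rw [← sub_eq_zero.1 h, norm_one] at hz'
    exact lt_irrefl _ hz'
  refine DifferentiableAt.differentiableWithinAt ?_
  have h2 : DifferentiableAt ℂ (fun z : ℂ => (1 + z) / (1 - z)) z :=
    DifferentiableAt.div (by fun_prop) (by fun_prop) h1
  exact (h2.clog (Or.inl (re_div_pos hz'))).const_mul _

lemma discToStrip_mem (hd : 0 < d) {z : ℂ} (hz : ‖z‖ < 1) : discToStrip d z ∈ strip d := by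
  have hpi := Real.pi_pos
  have h1 := Complex.abs_arg_lt_pi_div_two_iff.2 (Or.inl (re_div_pos hz))
  rw [strip, Set.mem_ofPred_eq, discToStrip, Complex.im_ofReal_mul, Complex.log_im, abs_mul,
    abs_of_pos (by positivity)]
  calc 2 * d / Real.pi * |((1 + z) / (1 - z)).arg| < 2 * d / Real.pi * (Real.pi / 2) := by gcongr
    _ = d := by field_simp

lemma discToStrip_T (hd : 0 < d) (x : ℝ) : discToStrip d (T d x : ℂ) = x := by
  have hpi := Real.pi_pos
  set y := Real.pi / (4 * d) * x with hy
  have hc := Real.cosh_pos y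
  have h1 : (1 + T d x) / (1 - T d x) = Real.exp (2 * y) := by
    have hne : Real.cosh y - Real.sinh y ≠ 0 := by rw [Real.cosh_sub_sinh]; positivity
    rw [T, ← hy, Real.tanh_eq_sinh_div_cosh, one_add_div hc.ne', one_sub_div hc.ne',
      div_div_div_cancel_right₀ hc.ne', Real.cosh_add_sinh, Real.cosh_sub_sinh, ← Real.exp_sub]
    congr 1
    ring
  have h2 : ((1 : ℂ) + T d x) / (1 - T d x) = ((Real.exp (2 * y) : ℝ) : ℂ) := by
    rw [← h1]; push_cast; rfl
  rw [discToStrip, h2, ← Complex.ofReal_log (Real.exp_pos _).le, Real.log_exp, ← Complex.ofReal_mul]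
  congr 1
  rw [hy]
  field_simp
  ring

lemma deriv_T (x : ℝ) : deriv (T d) x =
    Real.pi / (4 * d) * (1 - T d x ^ 2) := by
  have h := (hasDerivAt_tanh (Real.pi / (4 * d) * x)).comp x
    ((hasDerivAt_id x).const_mul (Real.pi / (4 * d)))
  have h2 : HasDerivAt (T d) _ x := h
  rw [h2.deriv, T, Real.tanh_eq_sinh_div_cosh]
  have hc := Real.cosh_pos (Real.pi / (4 * d) * x)
  rw [div_pow, one_sub_div (by positivity), Real.cosh_sq_sub_sinh_sq]
  ring

lemma deriv_T_div (hd : 0 < d) (x : ℝ) : deriv (T d) x / deriv (T d) 0 = 1 - T d x ^ 2 := by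
  have hpi := Real.pi_pos
  rw [deriv_T, deriv_T, T_zero]
  field_simp
  ring

lemma blaschkeOmit_eq (a : Fin n → ℝ) (k : Fin n) (x : ℝ) :
    blaschkeOmit d a k x = ∏ j ∈ Finset.univ.erase k, T d (x - a j) := by
  simp only [blaschkeOmit, T_sub]

/-- The formula interpolates at its nodes. -/
lemma interp_node (hd : 0 < d) (hw : IsWeight d w) {a : Fin n → ℝ} (ha : Function.Injective a)
    (f : ℂ → ℂ) (i : Fin n) : interp d w a f (a i) = f (a i) := by
  have hwi : w (a i) ≠ 0 := hw.ne_zero _ (ofReal_mem_strip hd _)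
  rw [interp, Finset.sum_eq_single i]
  · have h1 : blaschkeOmit d a i (a i) ≠ 0 := by
      rw [blaschkeOmit_eq]
      refine Finset.prod_ne_zero_iff.2 fun j hj => T_ne_zero hd (sub_ne_zero.2 (ha.ne ?_))
      exact (Finset.ne_of_mem_erase hj).symm
    have h2 : (blaschkeOmit d a i (a i) : ℂ) ≠ 0 := by exact_mod_cast h1
    rw [deriv_T_div hd, sub_self, T_zero, div_self (mul_ne_zero h2 hwi)]
    simp
  · intro k _ hk
    have h1 : blaschkeOmit d a k (a i) = 0 := by
      rw [blaschkeOmit_eq]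
      exact Finset.prod_eq_zero (Finset.mem_erase.2 ⟨hk.symm, Finset.mem_univ i⟩)
        (by rw [sub_self, T_zero])
    simp [h1]
  · simp

lemma norm_div_le_one_of_mem_unitBall {f : ℂ → ℂ} (hf : f ∈ unitBall d w) {z : ℂ}
    (hz : z ∈ strip d) : ‖f z / w z‖ ≤ 1 := by
  have h1 : ‖f z / w z‖ₑ ≤ 1 := (le_iSup₂ (f := fun z _ => ‖f z / w z‖ₑ) z hz).trans hf.2
  rw [← ofReal_norm] at h1
  simpa using h1

/-- Away from the nodes, the formula is the optimal one of the disc, transplanted by the conformal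
map which sends the centre to `x`. -/
lemma norm_sub_interp_le (hd : 0 < d) (hw : IsWeight d w) {a : Fin n → ℝ}
    (ha : Function.Injective a) {f : ℂ → ℂ} (hf : f ∈ unitBall d w) (x : ℝ) :
    ‖f x - interp d w a f x‖ ≤ (w x).re * ∏ j, |T d (x - a j)| := by
  have hwx := (hw.real_values x).2.1
  by_cases hx : x ∈ Set.range a
  · obtain ⟨i, rfl⟩ := hx
    rw [interp_node hd hw ha, sub_self, norm_zero]
    exact mul_nonneg hwx.le (Finset.prod_nonneg fun _ _ => abs_nonneg _)
  set β : Fin n → ℝ := fun k => T d (a k - x) with hβ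
  set g : ℂ → ℂ := fun z => f (x + discToStrip d z) / w (x + discToStrip d z) with hg
  have hmem : ∀ z : ℂ, ‖z‖ < 1 → (x : ℂ) + discToStrip d z ∈ strip d := fun z hz =>
    ofReal_add_mem_strip.2 (discToStrip_mem hd hz)
  have hgd : DifferentiableOn ℂ g (Metric.ball 0 1) := by
    have h1 : DifferentiableOn ℂ (fun z => (x : ℂ) + discToStrip d z) (Metric.ball 0 1) :=
      differentiableOn_discToStrip.const_add _
    have h2 : Set.MapsTo (fun z => (x : ℂ) + discToStrip d z) (Metric.ball 0 1) (strip d) :=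
      fun z hz => hmem z (by simpa using hz)
    exact (hf.1.differentiableOn.comp h1 h2).div (hw.differentiableOn.comp h1 h2)
      fun z hz => hw.ne_zero _ (h2 hz)
  have h := norm_sub_sum_discCoeff_le (β := β) (g := g)
    (fun i j hij => ha (sub_left_injective ((strictMono_T hd).injective hij)))
    (fun k => T_ne_zero hd (sub_ne_zero.2 fun e => hx ⟨k, e⟩)) (fun k => abs_T_lt_one _) hgd
    (fun z hz => norm_div_le_one_of_mem_unitBall hf (hmem z (by simpa using hz)))
  have hg0 : g 0 = f x / w x := by simp [hg, discToStrip]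
  have hgk : ∀ k, g (β k) = f (a k) / w (a k) := by
    intro k
    simp only [hg, hβ, discToStrip_T hd]
    push_cast
    rw [add_sub_cancel]
  have hwx0 : w x ≠ 0 := hw.ne_zero _ (ofReal_mem_strip hd x)
  have hterm : f x - interp d w a f x = w x * (g 0 - ∑ k, g (β k) * discCoeff β k) := by
    rw [mul_sub, hg0, mul_div_cancel₀ _ hwx0, Finset.mul_sum, interp]
    congr 1
    refine Finset.sum_congr rfl fun k _ => ?_
    have hwk : w (a k) ≠ 0 := hw.ne_zero _ (ofReal_mem_strip hd _)
    have e1 : T d (x - a k) ^ 2 = β k ^ 2 := by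
      rw [← neg_sub (a k) x, T_neg, neg_sq]
    have e2 : discCoeff β k = (1 - β k ^ 2) * (blaschkeOmit d a k x / blaschkeOmit d a k (a k)) := by
      rw [discCoeff, blaschkeOmit_eq, blaschkeOmit_eq, ← Finset.prod_div_distrib]
      congr 1
      refine Finset.prod_congr rfl fun j _ => ?_
      simp only [hβ, T_sub]
      rw [← T_neg, neg_sub, sub_sub_sub_cancel_right]
    rw [hgk, e2, deriv_T_div hd, e1]
    push_cast
    rw [mul_div_mul_comm]
    ring
  rw [hterm, norm_mul, hw.norm_eq]
  refine mul_le_mul_of_nonneg_left (h.trans (le_of_eq ?_)) hwx.le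
  refine Finset.prod_congr rfl fun j _ => ?_
  simp only [hβ]
  rw [← neg_sub x (a j), T_neg, abs_neg]

/-- The worst error of the interpolation formula with optimal nodes. -/
lemma IsDiscMinimizer.worstError_interp_le (hd : 0 < d) (hw : IsWeight d w) (hn : 2 ≤ n)
    {a : Fin n → ℝ} (ha : IsDiscMinimizer d w a) : worstError d w (interp d w a) ≤
      ENNReal.ofReal (Real.exp (-(discF d w a / ((n : ℝ) - 1)))) := by
  refine iSup₂_le fun f hf => iSup_le fun x => ?_
  rw [← ofReal_norm]
  refine ENNReal.ofReal_le_ofReal ((norm_sub_interp_le hd hw ha.1.injective hf x).trans ?_)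
  by_cases hx : x ∈ Set.range a
  · obtain ⟨i, rfl⟩ := hx
    rw [Finset.prod_eq_zero (Finset.mem_univ i) (by rw [sub_self, T_zero, abs_zero]), mul_zero]
    positivity
  · have h1 : ∀ j, |T d (x - a j)| = Real.exp (-kernelReal d (x - a j)) := fun j =>
      (exp_neg_kernelReal hd fun h => hx ⟨j, (sub_eq_zero.1 h).symm⟩).symm
    simp_rw [h1]
    rw [← Real.exp_sum, ← hw.exp_neg_field, ← Real.exp_add, Finset.sum_neg_distrib]
    refine Real.exp_le_exp.2 ?_
    linarith [ha.discF_le hn hx]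

end

section

variable {d : ℝ} {w : ℂ → ℂ} {n : ℕ}

/-! ### A lower bound for the minimum error -/

/-- The Blaschke factor of the strip with zero at `p`; its modulus is the exponential of minus the
Green function with pole `p`. -/
noncomputable def stripFactor (d : ℝ) (p z : ℂ) : ℂ :=
  Complex.sinh ((Real.pi / (4 * d) : ℝ) * (z - p)) /
    Complex.cosh ((Real.pi / (4 * d) : ℝ) * (z - conj p))

lemma norm_sinh_sq (z : ℂ) : ‖Complex.sinh z‖ ^ 2 = Real.sinh z.re ^ 2 + Real.sin z.im ^ 2 := by
  have h : Complex.sinh z = ((Real.sinh z.re * Real.cos z.im : ℝ) : ℂ) +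
      ((Real.cosh z.re * Real.sin z.im : ℝ) : ℂ) * Complex.I := by
    conv_lhs => rw [← Complex.re_add_im z, Complex.sinh_add, Complex.cosh_mul_I,
      Complex.sinh_mul_I]
    push_cast
    ring
  rw [h, ← Complex.normSq_eq_norm_sq, Complex.normSq_add_mul_I, mul_pow, mul_pow, Real.cosh_sq,
    Real.cos_sq']
  ring

lemma norm_cosh_sq (z : ℂ) : ‖Complex.cosh z‖ ^ 2 = Real.sinh z.re ^ 2 + Real.cos z.im ^ 2 := by
  have h : Complex.cosh z = ((Real.cosh z.re * Real.cos z.im : ℝ) : ℂ) +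
      ((Real.sinh z.re * Real.sin z.im : ℝ) : ℂ) * Complex.I := by
    conv_lhs => rw [← Complex.re_add_im z, Complex.cosh_add, Complex.cosh_mul_I,
      Complex.sinh_mul_I]
    push_cast
    ring
  rw [h, ← Complex.normSq_eq_norm_sq, Complex.normSq_add_mul_I, mul_pow, mul_pow, Real.cosh_sq,
    Real.sin_sq]
  ring

lemma abs_mul_im_lt (hd : 0 < d) {z : ℂ} (hz : z ∈ strip d) :
    |Real.pi / (4 * d) * z.im| < Real.pi / 4 := by
  have hpi := Real.pi_pos
  have hz' : |z.im| < d := hz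
  rw [abs_mul, abs_of_pos (by positivity)]
  calc Real.pi / (4 * d) * |z.im| < Real.pi / (4 * d) * d := by gcongr
    _ = Real.pi / 4 := by field_simp

lemma cosh_sub_conj_ne_zero (hd : 0 < d) {p z : ℂ} (hp : p ∈ strip d) (hz : z ∈ strip d) :
    Complex.cosh ((Real.pi / (4 * d) : ℝ) * (z - conj p)) ≠ 0 := by
  have h1 := abs_lt.1 (abs_mul_im_lt hd hp)
  have h2 := abs_lt.1 (abs_mul_im_lt hd hz)
  intro h
  have h3 := norm_cosh_sq ((Real.pi / (4 * d) : ℝ) * (z - conj p))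
  rw [h, norm_zero] at h3
  simp only [Complex.im_ofReal_mul, Complex.sub_im, Complex.conj_im, sub_neg_eq_add] at h3
  have h4 : 0 < Real.cos (Real.pi / (4 * d) * (z.im + p.im)) :=
    Real.cos_pos_of_mem_Ioo ⟨by linarith, by linarith⟩
  nlinarith [pow_pos h4 2, sq_nonneg (Real.sinh (((Real.pi / (4 * d) : ℝ) * (z - conj p) : ℂ).re))]

lemma analyticAt_stripFactor (hd : 0 < d) {p z : ℂ} (hp : p ∈ strip d) (hz : z ∈ strip d) :
    AnalyticAt ℂ (stripFactor d p) z := by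
  unfold stripFactor
  refine AnalyticAt.div ?_ ?_ (cosh_sub_conj_ne_zero hd hp hz)
  · exact (Complex.differentiable_sinh.comp (by fun_prop)).analyticAt z
  · exact (Complex.differentiable_cosh.comp (by fun_prop)).analyticAt z

lemma stripFactor_self (p : ℂ) : stripFactor d p p = 0 := by simp [stripFactor]

lemma norm_stripFactor_le_one (hd : 0 < d) {p z : ℂ} (hp : p ∈ strip d) (hz : z ∈ strip d) :
    ‖stripFactor d p z‖ ≤ 1 := by
  have h1 := abs_lt.1 (abs_mul_im_lt hd hp)
  have h2 := abs_lt.1 (abs_mul_im_lt hd hz)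
  set s := Real.pi / (4 * d) with hs
  rw [stripFactor, norm_div]
  refine div_le_one_of_le₀ ?_ (norm_nonneg _)
  refine le_of_sq_le_sq ?_ (norm_nonneg _)
  rw [norm_sinh_sq, norm_cosh_sq]
  simp only [Complex.re_ofReal_mul, Complex.im_ofReal_mul, Complex.sub_re, Complex.sub_im,
    Complex.conj_re, Complex.conj_im, sub_neg_eq_add]
  have h3 : 0 < Real.cos (2 * (s * z.im)) := Real.cos_pos_of_mem_Ioo ⟨by linarith, by linarith⟩
  have h4 : 0 < Real.cos (2 * (s * p.im)) := Real.cos_pos_of_mem_Ioo ⟨by linarith, by linarith⟩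
  have h5 := mul_pos h3 h4
  rw [show 2 * (s * z.im) = s * (z.im + p.im) + s * (z.im - p.im) by ring,
    show 2 * (s * p.im) = s * (z.im + p.im) - s * (z.im - p.im) by ring, Real.cos_add,
    Real.cos_sub] at h5
  nlinarith [Real.sin_sq_add_cos_sq (s * (z.im + p.im)), Real.sin_sq_add_cos_sq (s * (z.im - p.im))]

/-- Moving the zero of a Blaschke factor to the real axis decreases its modulus on the axis. -/
lemma abs_T_le_norm_stripFactor (hd : 0 < d) {p : ℂ} (hp : p ∈ strip d) (x : ℝ) :
    |T d (x - p.re)| ≤ ‖stripFactor d p x‖ := by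
  have hcosh := norm_pos_iff.2 (cosh_sub_conj_ne_zero hd hp (ofReal_mem_strip hd x))
  have hc := Real.cosh_pos (Real.pi / (4 * d) * (x - p.re))
  rw [stripFactor, norm_div, T, Real.tanh_eq_sinh_div_cosh, abs_div, abs_of_pos hc,
    div_le_div_iff₀ hc hcosh]
  refine le_of_sq_le_sq ?_ (by positivity)
  rw [mul_pow, mul_pow, norm_sinh_sq, norm_cosh_sq, sq_abs, Real.cosh_sq]
  simp only [Complex.re_ofReal_mul, Complex.im_ofReal_mul, Complex.sub_re, Complex.sub_im,
    Complex.conj_re, Complex.conj_im, sub_neg_eq_add, Complex.ofReal_re, Complex.ofReal_im,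
    zero_add, zero_sub, mul_neg, Real.sin_neg, neg_sq]
  nlinarith [Real.sin_sq_add_cos_sq (Real.pi / (4 * d) * p.im),
    sq_nonneg (Real.sin (Real.pi / (4 * d) * p.im)),
    sq_nonneg (Real.sinh (Real.pi / (4 * d) * (x - p.re)))]

/-- The weighted Blaschke product which vanishes to order `m j` at `p j`. It belongs to the unit
ball and every Hermite type formula with these data maps it to zero. -/
noncomputable def testFunction (d : ℝ) (w : ℂ → ℂ) {l : ℕ} (m : Fin l → ℕ) (p : Fin l → ℂ) (z : ℂ) :
    ℂ := w z * ∏ j, stripFactor d (p j) z ^ m j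

variable {l : ℕ} {m : Fin l → ℕ} {p : Fin l → ℂ}

lemma analyticAt_prod_stripFactor (hd : 0 < d) (hp : ∀ j, p j ∈ strip d) (s : Finset (Fin l))
    {z : ℂ} (hz : z ∈ strip d) : AnalyticAt ℂ (fun z => ∏ j ∈ s, stripFactor d (p j) z ^ m j) z :=
  Finset.analyticAt_fun_prod s fun j _ => (analyticAt_stripFactor hd (hp j) hz).fun_pow (m j)

lemma testFunction_mem_unitBall (hd : 0 < d) (hw : IsWeight d w) (hp : ∀ j, p j ∈ strip d) :
    testFunction d w m p ∈ unitBall d w := by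
  refine ⟨fun z hz => (hw.analytic z hz).fun_mul (analyticAt_prod_stripFactor hd hp _ hz),
    iSup₂_le fun z hz => ?_⟩
  rw [testFunction, mul_div_cancel_left₀ _ (hw.ne_zero z hz), ← ofReal_norm, norm_prod,
    ENNReal.ofReal_le_one]
  refine Finset.prod_le_one (fun _ _ => norm_nonneg _) fun j _ => ?_
  rw [norm_pow]
  exact pow_le_one₀ (norm_nonneg _) (norm_stripFactor_le_one hd (hp j) hz)

lemma iteratedDeriv_testFunction (hd : 0 < d) (hw : IsWeight d w) (hp : ∀ j, p j ∈ strip d)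
    {j : Fin l} {k : ℕ} (hk : k < m j) : iteratedDeriv k (testFunction d w m p) (p j) = 0 := by
  have hG := analyticAt_stripFactor hd (hp j) (hp j)
  have hrest : AnalyticAt ℂ
      (fun z => w z * ∏ i ∈ Finset.univ.erase j, stripFactor d (p i) z ^ m i) (p j) :=
    (hw.analytic _ (hp j)).fun_mul (analyticAt_prod_stripFactor hd hp _ (hp j))
  have e : testFunction d w m p = (stripFactor d (p j)) ^ m j *
      fun z => w z * ∏ i ∈ Finset.univ.erase j, stripFactor d (p i) z ^ m i := by
    ext z
    rw [testFunction, ← Finset.mul_prod_erase _ _ (Finset.mem_univ j), Pi.mul_apply, Pi.pow_apply]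
    ring
  have h1 : (1 : ℕ∞) ≤ analyticOrderAt (stripFactor d (p j)) (p j) :=
    Order.one_le_iff_pos.2 (pos_iff_ne_zero.2
      (hG.analyticOrderAt_ne_zero.2 (stripFactor_self (p j))))
  have h2 : (m j : ℕ∞) ≤ analyticOrderAt (testFunction d w m p) (p j) := by
    rw [e, analyticOrderAt_mul (hG.pow _) hrest, analyticOrderAt_pow hG]
    refine le_add_right ?_
    rw [nsmul_eq_mul]
    exact le_mul_of_one_le_right zero_le h1
  have hf := (testFunction_mem_unitBall (m := m) hd hw hp).1 _ (hp j)
  exact (natCast_le_analyticOrderAt_iff_iteratedDeriv_eq_zero hf).1 h2 k hk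

lemma le_worstError_hermiteFormula (hd : 0 < d) (hw : IsWeight d w) (hp : ∀ j, p j ∈ strip d)
    (φ : Fin l → ℕ → ℂ → ℂ) (x : ℝ) :
    ENNReal.ofReal ((w x).re * ∏ j, |T d (x - (p j).re)| ^ m j) ≤
      worstError d w (hermiteFormula m p φ) := by
  have h0 : hermiteFormula m p φ (testFunction d w m p) x = 0 :=
    Finset.sum_eq_zero fun j _ => Finset.sum_eq_zero fun k hk => by
      rw [iteratedDeriv_testFunction hd hw hp (Finset.mem_range.1 hk), zero_mul]
  refine le_trans ?_ (le_iSup₂_of_le (f := fun f _ => ⨆ x : ℝ, ‖f x - hermiteFormula m p φ f x‖ₑ)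
    _ (testFunction_mem_unitBall (m := m) hd hw hp) (le_iSup _ x))
  rw [h0, sub_zero, ← ofReal_norm, testFunction, norm_mul, hw.norm_eq, norm_prod]
  refine ENNReal.ofReal_le_ofReal (mul_le_mul_of_nonneg_left ?_ (hw.real_values x).2.1.le)
  refine Finset.prod_le_prod (fun _ _ => by positivity) fun j _ => ?_
  rw [norm_pow]
  exact pow_le_pow_left₀ (abs_nonneg _) (abs_T_le_norm_stripFactor hd (hp j) x) _

/-- No formula with `n` data has an error below `exp (-F / n)`, where `F` belongs to any minimizer
of the continuous energy. -/
lemma IsContMinimizer.exp_le_minError (hd : 0 < d) (hw : IsWeight d w) (hn : n ≠ 0)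
    {μ : Measure ℝ} (hμ : IsContMinimizer d w n μ) (hfin : contEnergy d w μ ≠ ⊤)
    (hF : contF d w μ ≠ ⊤) :
    ENNReal.ofReal (Real.exp (-((contF d w μ).toReal / n))) ≤ minError d w n := by
  refine le_sInf ?_
  rintro _ ⟨l, m, p, φ, -, -, hm1, hm, -, hp, -, rfl⟩
  by_contra hcon
  push Not at hcon
  obtain ⟨y, hy0, hEy, hy⟩ := ENNReal.lt_iff_exists_real_btwn.1 hcon
  have hy' : y < Real.exp (-((contF d w μ).toReal / n)) :=
    (ENNReal.ofReal_lt_ofReal_iff (Real.exp_pos _)).1 hy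
  have hy1 : 0 < y := by
    refine hy0.lt_of_ne fun e => ?_
    rw [← e, ENNReal.ofReal_zero] at hEy
    exact not_lt_zero hEy
  have hc : ∀ x : ℝ, ENNReal.ofReal (-Real.log y) ≤
      ∑ j, (m j : ℝ≥0∞) * kernel d (x - (p j).re) + ENNReal.ofReal (field w x) := by
    intro x
    by_cases hx : ∃ j, x = (p j).re
    · obtain ⟨j, rfl⟩ := hx
      have h1 := Finset.single_le_sum (f := fun i => (m i : ℝ≥0∞) * kernel d ((p j).re - (p i).re))
        (fun _ _ => zero_le) (Finset.mem_univ j)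
      have h2 : (m j : ℝ≥0∞) ≠ 0 := by exact_mod_cast (Nat.one_le_iff_ne_zero.1 (hm1 j))
      simp only [sub_self, kernel_zero, ENNReal.mul_top h2, top_le_iff] at h1
      rw [h1, top_add]
      exact le_top
    · push Not at hx
      have hne : ∀ j, x - (p j).re ≠ 0 := fun j => sub_ne_zero.2 (hx j)
      have h1 : ∀ j, (m j : ℝ≥0∞) * kernel d (x - (p j).re) =
          ENNReal.ofReal (m j * kernelReal d (x - (p j).re)) := fun j => by
        rw [kernel_of_ne (hne j), ENNReal.ofReal_mul (Nat.cast_nonneg _), ENNReal.ofReal_natCast]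
      have hnn : ∀ j, 0 ≤ (m j : ℝ) * kernelReal d (x - (p j).re) := fun j =>
        mul_nonneg (Nat.cast_nonneg _) (kernelReal_nonneg _)
      simp_rw [h1]
      rw [← ENNReal.ofReal_sum_of_nonneg fun j _ => hnn j,
        ← ENNReal.ofReal_add (Finset.sum_nonneg fun j _ => hnn j) (hw.field_nonneg x)]
      refine ENNReal.ofReal_le_ofReal ?_
      have h2 := ((le_worstError_hermiteFormula (m := m) hd hw hp φ x).trans_lt hEy).le
      rw [ENNReal.ofReal_le_ofReal_iff hy0] at h2
      have h3 : ∀ j, |T d (x - (p j).re)| ^ m j =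
          Real.exp (-(m j * kernelReal d (x - (p j).re))) := fun j => by
        rw [← exp_neg_kernelReal hd (hne j), ← Real.exp_nat_mul, mul_neg]
      simp_rw [h3] at h2
      rw [← Real.exp_sum, ← hw.exp_neg_field, ← Real.exp_add, ← Real.le_log_iff_exp_le hy1,
        Finset.sum_neg_distrib] at h2
      linarith
  have h := hμ.mul_le_contF hd hw hn hfin m hm (fun j => (p j).re) hc
  rw [← ENNReal.ofReal_natCast, ← ENNReal.ofReal_mul (Nat.cast_nonneg _),
    ENNReal.ofReal_le_iff_le_toReal hF] at h
  have hn' : (0 : ℝ) < n := by exact_mod_cast Nat.pos_of_ne_zero hn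
  have h1 : Real.log y < -((contF d w μ).toReal / n) := (Real.log_lt_iff_lt_exp hy1).2 hy'
  have h2 : (contF d w μ).toReal / n < -Real.log y := by linarith
  rw [div_lt_iff₀ hn'] at h2
  linarith

end

section

variable {d : ℝ} {w : ℂ → ℂ} {n : ℕ}

/-! ### Comparison of the energies, and near optimality -/

lemma contF_le_contEnergy (μ : Measure ℝ) : contF d w μ ≤ contEnergy d w μ := by
  unfold contF contEnergy
  gcongr
  exact le_mul_of_one_le_left zero_le (by norm_num)

lemma IsContMinimizer.contEnergy_le (hd : 0 < d) (hw : IsWeight d w) (hn : 2 ≤ n) {μ : Measure ℝ}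
    (hμ : IsContMinimizer d w n μ) {a : Fin n → ℝ} (ha : StrictMono a) :
    contEnergy d w μ ≤ ENNReal.ofReal (((n : ℝ) / (n - 1)) ^ 2 *
      (2 * discF d w a + (n - 1) * (3 + Real.log 2))) := by
  obtain ⟨ν, hν, hE⟩ := exists_contEnergy_le hd hw hn ha
  exact (hμ.2 ν hν).trans hE

lemma IsContMinimizer.contEnergy_ne_top (hd : 0 < d) (hw : IsWeight d w) (hn : 2 ≤ n)
    {μ : Measure ℝ} (hμ : IsContMinimizer d w n μ) : contEnergy d w μ ≠ ⊤ :=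
  ne_top_of_le_ne_top ENNReal.ofReal_ne_top
    (hμ.contEnergy_le hd hw hn (a := fun i => ((i : ℕ) : ℝ)) fun _ _ h => Nat.cast_lt.2 h)

lemma IsContMinimizer.contF_ne_top (hd : 0 < d) (hw : IsWeight d w) (hn : 2 ≤ n)
    {μ : Measure ℝ} (hμ : IsContMinimizer d w n μ) : contF d w μ ≠ ⊤ :=
  ne_top_of_le_ne_top (hμ.contEnergy_ne_top hd hw hn) (contF_le_contEnergy μ)

lemma IsDiscMinimizer.discF_le_contF (hd : 0 < d) (hw : IsWeight d w) (hn : 2 ≤ n)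
    {a : Fin n → ℝ} {μ : Measure ℝ} (ha : IsDiscMinimizer d w a) (hμ : IsContMinimizer d w n μ) :
    discF d w a / ((n : ℝ) - 1) ≤ (contF d w μ).toReal / n := by
  have hn' : (2 : ℝ) ≤ n := by exact_mod_cast hn
  have h := hμ.mul_le_contF hd hw (by omega) (hμ.contEnergy_ne_top hd hw hn) (fun _ => 1)
    (by simp) a (c := ENNReal.ofReal (discF d w a / ((n : ℝ) - 1)))
    (fun x => by simpa using ha.ofReal_discF_le hw hn x)
  rw [← ENNReal.ofReal_natCast, ← ENNReal.ofReal_mul (Nat.cast_nonneg _),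
    ENNReal.ofReal_le_iff_le_toReal (hμ.contF_ne_top hd hw hn)] at h
  rw [le_div_iff₀ (by linarith)]
  linarith

lemma IsContMinimizer.contF_le_discF (hd : 0 < d) (hw : IsWeight d w) (hn : 2 ≤ n)
    {a : Fin n → ℝ} {μ : Measure ℝ} (ha : StrictMono a) (hμ : IsContMinimizer d w n μ) :
    (contF d w μ).toReal / n ≤ (n : ℝ) / ((n : ℝ) - 1) *
      (2 * discF d w a / ((n : ℝ) - 1) + (3 + Real.log 2)) := by
  have hn' : (2 : ℝ) ≤ n := by exact_mod_cast hn
  have hn1 : 0 < (n : ℝ) - 1 := by linarith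
  have hF := discF_nonneg hw (by omega) a
  have hlog := Real.log_pos one_lt_two
  have h := (contF_le_contEnergy μ).trans (hμ.contEnergy_le hd hw hn ha)
  have h2 := ENNReal.toReal_le_of_le_ofReal (by positivity) h
  rw [div_le_iff₀ (by linarith)]
  refine h2.trans (le_of_eq ?_)
  field_simp

/-- Near optimality of the formula whose nodes minimize the discrete energy. -/
lemma IsDiscMinimizer.worstError_le_minError (hd : 0 < d) (hw : IsWeight d w) (hn : 2 ≤ n)
    {ε : ℝ} (hε : 0 < ε) (hnε : 2 + ε ≤ n * ε) {a : Fin n → ℝ} (ha : IsDiscMinimizer d w a) :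
    worstError d w (interp d w a) ≤
      ENNReal.ofReal (Real.sqrt (2 * Real.exp 3)) * minError d w n ^ (1 / (2 + ε)) := by
  have hn' : (2 : ℝ) ≤ n := by exact_mod_cast hn
  have hn1 : 0 < (n : ℝ) - 1 := by linarith
  obtain ⟨μ, hμ⟩ := hw.exists_isContMinimizer hd (n := n) (by omega)
  set x := discF d w a / ((n : ℝ) - 1) with hx
  set y := (contF d w μ).toReal / n with hy
  have hy0 : 0 ≤ y := by positivity
  have h1 : y ≤ (n : ℝ) / ((n : ℝ) - 1) * (2 * x + (3 + Real.log 2)) := by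
    have := hμ.contF_le_discF hd hw hn ha.1
    rwa [mul_div_assoc] at this
  have h2 : -x ≤ (Real.log 2 + 3) / 2 + -y * (1 / (2 + ε)) := by
    rw [div_mul_eq_mul_div, le_div_iff₀ hn1] at h1
    have h3 : y * (1 / (2 + ε)) * (2 * n) ≤ y * (n - 1) := by
      rw [mul_assoc]
      refine mul_le_mul_of_nonneg_left ?_ hy0
      rw [one_div_mul_eq_div, div_le_iff₀ (by linarith)]
      linarith
    have h4 : y * (1 / (2 + ε)) * 2 ≤ 2 * x + (3 + Real.log 2) := by
      refine le_of_mul_le_mul_right (a := (n : ℝ)) ?_ (by linarith)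
      linarith
    linarith
  have hsqrt : Real.sqrt (2 * Real.exp 3) = Real.exp ((Real.log 2 + 3) / 2) := by
    rw [Real.exp_half, Real.exp_add, Real.exp_log two_pos]
  have hmin := hμ.exp_le_minError hd hw (by omega) (hμ.contEnergy_ne_top hd hw hn)
    (hμ.contF_ne_top hd hw hn)
  calc worstError d w (interp d w a) ≤ ENNReal.ofReal (Real.exp (-x)) :=
        ha.worstError_interp_le hd hw hn
    _ ≤ ENNReal.ofReal (Real.exp ((Real.log 2 + 3) / 2 + -y * (1 / (2 + ε)))) :=
        ENNReal.ofReal_le_ofReal (Real.exp_le_exp.2 h2)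
    _ = ENNReal.ofReal (Real.sqrt (2 * Real.exp 3)) *
          ENNReal.ofReal (Real.exp (-y)) ^ (1 / (2 + ε)) := by
        rw [hsqrt, ENNReal.ofReal_rpow_of_pos (Real.exp_pos _), ← Real.exp_mul, Real.exp_add,
          ENNReal.ofReal_mul (Real.exp_pos _).le]
    _ ≤ _ := by
        gcongr

end

end HardyInterp

theorem theorem1 (d : ℝ) (hd : 0 < d) (w : ℂ → ℂ) (hw : HardyInterp.IsWeight d w) :
    (∀ n : ℕ, 2 ≤ n →
      (∃ a : Fin n → ℝ, HardyInterp.IsDiscMinimizer d w a) ∧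
      (∃ μ : Measure ℝ, HardyInterp.IsContMinimizer d w n μ) ∧
      ∀ (a : Fin n → ℝ) (μ : Measure ℝ),
        HardyInterp.IsDiscMinimizer d w a → HardyInterp.IsContMinimizer d w n μ →
        HardyInterp.contF d w μ ≠ ⊤ ∧
        HardyInterp.discF d w a / ((n : ℝ) - 1) ≤ (HardyInterp.contF d w μ).toReal / n ∧
        (HardyInterp.contF d w μ).toReal / n ≤
          (n : ℝ) / ((n : ℝ) - 1) *
            (2 * HardyInterp.discF d w a / ((n : ℝ) - 1) + (3 + Real.log 2))) ∧
    (∀ ε : ℝ, 0 < ε → ∀ᶠ n : ℕ in atTop, ∀ a : Fin n → ℝ,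
      HardyInterp.IsDiscMinimizer d w a →
        HardyInterp.worstError d w (HardyInterp.interp d w a) ≤
          ENNReal.ofReal (Real.sqrt (2 * Real.exp 3)) *
            HardyInterp.minError d w n ^ (1 / (2 + ε))) := by
  refine ⟨fun n hn => ⟨hw.exists_isDiscMinimizer hd hn, hw.exists_isContMinimizer hd (by omega),
    fun a μ ha hμ => ⟨hμ.contF_ne_top hd hw hn, ha.discF_le_contF hd hw hn hμ,
      hμ.contF_le_discF hd hw hn ha.1⟩⟩, fun ε hε => ?_⟩
  obtain ⟨N, hN⟩ := exists_nat_ge ((2 + ε) / ε)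
  filter_upwards [eventually_ge_atTop (max 2 N)] with n hn a ha
  refine ha.worstError_le_minError hd hw ((le_max_left _ _).trans hn) hε ?_
  rw [← div_le_iff₀ hε]
  exact hN.trans (by exact_mod_cast (le_max_right _ _).trans hn)
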